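/- **Setting.** Let $\mathbb{F}_q$ be a finite field with $q$ elements, let $C$ and $C'$ be smooth projective geometrically irreducible curves over $\mathbb{F}_q$, and let $\pi:C'\to C$ be a finite morphism over $\mathbb{F}_q$ of degree $n$. Let $\infty\in C$ be a closed point with exactly one point $\infty'\in C'$ above it. Put $A=\Gamma(C\setminus\{\infty\},\mathcal{O}_C)$ and $A'=\Gamma(C'\setminus\{\infty'\},\mathcal{O}_{C'})$, and view $A'$ as an $A$-algebra via $\pi^*:A\to A'$. Let $\mathrm{ord}_\infty$ be the normalized valuation at $\infty$ and $\deg(\infty)=[\kappa(\infty):\mathbb{F}_q]$. **Drinfeld modules.** Let $r\ge 1$ and let $c:S\to\operatorname{Spec}A$ be a morphism of schemes. A *Drinfeld-$A$-module of rank $r$ and characteristic $c$ over $S$* is a pair $(E,\phi)$ of a commutative group scheme $E$ over $S$ and a ring homomorphism $\phi:A\to\operatorname{End}_S(E)$, where $E$ is regarded as a scheme in $\mathbb{F}_q$-modules through $\phi|_{\mathbb{F}_q}$, such that (i) $E$ is Zariski-locally on $S$ isomorphic, $\mathbb{F}_q$-linearly, to $\mathbb{G}_{a,S}$, and (ii)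 for every affine open $U=\operatorname{Spec}B$ of $S$, every $\mathbb{F}_q$-linear isomorphism $\psi:E_U\to\mathbb{G}_{a,U}$ of group schemes and every $a\in A\setminus\{0\}$, one has $\psi\circ\phi(a)\circ\psi^{-1}=\sum_i\delta_i(a)\tau^i$ (a finite sum with $\delta_i(a)\in B$), where $\tau$ is the $q$-Frobenius of $\mathbb{G}_{a,U}$, $\delta_0(a)=c^*(a)$, $\delta_i(a)\in B^\times$ for $i=d(a):=-r\,\mathrm{ord}_\infty(a)\deg(\infty)$, and $\delta_i(a)$ is nilpotent for $i>d(a)$. Isomorphisms are isomorphisms of group schemes over $S$ commuting with the actions of $A$. Drinfeld-$A'$-modules are defined in the same way from $(C',\infty')$. **Moduli functors.** Let $\underline{\mathrm{Dr}\text{-}A\text{-}\mathrm{Mod}}^{r}$ be the contravariant functor that maps a scheme $S$ to the set of pairs of a morphism $c:S\to\operatorname{Spec}A$ and an isomorphism class of Drinfeld-$A$-modules of rank $r$ and characteristic $c$ over $S$, with pullback as transition maps. **Theorem.** Let $r'\ge 1$. Restriction of coefficients $(E',\phi')\mapsto(E',\phi'\circ\pi^*)$, together with $c'\mapsto \operatorname{Spec}(\pi^*)\circ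 c'$ on characteristics, defines a morphism of functors $$\pi_*:\ \underline{\mathrm{Dr}\text{-}A'\text{-}\mathrm{Mod}}^{r'}\longrightarrow\underline{\mathrm{Dr}\text{-}A\text{-}\mathrm{Mod}}^{nr'},$$ and $\pi_*$ satisfies the valuative criterion for properness: for every valuation ring $R$ with fraction field $K$, every $x\in\underline{\mathrm{Dr}\text{-}A'\text{-}\mathrm{Mod}}^{r'}(\operatorname{Spec}K)$ and every $y\in\underline{\mathrm{Dr}\text{-}A\text{-}\mathrm{Mod}}^{nr'}(\operatorname{Spec}R)$ with $\pi_*(x)=y|_{\operatorname{Spec}K}$, there is exactly one $z\in\underline{\mathrm{Dr}\text{-}A'\text{-}\mathrm{Mod}}^{r'}(\operatorname{Spec}R)$ with $z|_{\operatorname{Spec}K}=x$ and $\pi_*(z)=y$. -/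

import Mathlib

open CategoryTheory AlgebraicGeometry Opposite

universe u

noncomputable section

namespace DrinfeldRestriction

/-! ## Curves with a point at infinity -/

/-- A smooth projective geometrically irreducible curve `X` over the field `k`, together with a
closed point `pt` (the point `∞`). For curves over a field, proper and projective are the
same. -/
structure PointedCurve (k : Type u) [Field k] where
  X : Scheme.{u}
  str : X ⟶ Spec (.of k)
  isIntegral : IsIntegral X
  proper : IsProper str
  smooth : SmoothOfRelativeDimension 1 str
  geomIrred : GeometricallyIrreducible str
  pt : X
  isClosed_pt : IsClosed ({pt} : Set X)

theorem not_isStandardSmooth_one {F L : Type u} [Field F] [Finite F] [Field L] [Algebra F L]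
    [Algebra.IsStandardSmoothOfRelativeDimension 1 F L] : False := by
  have : Algebra.IsStandardSmooth F L :=
    Algebra.IsStandardSmoothOfRelativeDimension.isStandardSmooth 1
  have : Module.Finite F L := finite_of_finite_type_of_isJacobsonRing _ _
  have h1 := Algebra.IsStandardSmoothOfRelativeDimension.rank_kaehlerDifferential
    (R := F) (S := L) 1
  have : Algebra.FormallyUnramified F L := Algebra.FormallyUnramified.of_isSeparable _ _
  rw [rank_subsingleton'] at h1
  simp at h1

namespace PointedCurve

attribute [instance] isIntegral proper smooth geomIrred

variable {k : Type u} [Field k] (C : PointedCurve k)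

instance : IsLocallyNoetherian C.X := LocallyOfFiniteType.isLocallyNoetherian C.str

/-- A closed point of a curve over a finite field is not the generic point. -/
theorem genericPoint_ne [Finite k] : genericPoint C.X ≠ C.pt := by
  intro h
  have huniv : ∀ x : C.X, x = C.pt := fun x => by
    have := (genericPoint_spec C.X).specializes (Set.mem_univ x)
    rw [h] at this
    have := this.mem_closed C.isClosed_pt rfl
    simpa using this
  have hs : Subsingleton C.X := ⟨fun x y => (huniv x).trans (huniv y).symm⟩
  obtain ⟨U, hU, V, hV, hx, e, hst⟩ :=
    SmoothOfRelativeDimension.exists_isStandardSmoothOfRelativeDimension (f := C.str) (n := 1) C.pt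
  have hVt : V = ⊤ := by ext y; simp [Subsingleton.elim y C.pt, hx]
  have hUt : U = ⊤ := by
    ext y
    have : y = C.str C.pt := Subsingleton.elim _ _
    simpa [this] using e hx
  subst hVt hUt
  have f1 : IsField Γ(C.X, ⊤) := isField_of_isIntegral_of_subsingleton _
  have f2 : IsField Γ(Spec (.of k), ⊤) := isField_of_isIntegral_of_subsingleton _
  let _ := f1.toField
  let _ := f2.toField
  have : Finite Γ(Spec (.of k), ⊤) :=
    Finite.of_injective _ (Scheme.ΓSpecIso (.of k)).commRingCatIsoToRingEquiv.injective
  algebraize [(C.str.appLE ⊤ ⊤ e).hom]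
  exact not_isStandardSmooth_one (F := Γ(Spec (.of k), ⊤)) (L := Γ(C.X, ⊤))
/-- The open subscheme `X ∖ {∞}`. -/
def affinePart : C.X.Opens := ⟨{C.pt}ᶜ, C.isClosed_pt.isOpen_compl⟩

/-- The ring `A = Γ(X ∖ {∞}, 𝒪)`. -/
def coordRing : CommRingCat.{u} := Γ(C.X, C.affinePart)

/-- The inclusion of the constants `k → A`. -/
def constants : k →+* C.coordRing :=
  ((Scheme.ΓSpecIso (.of k)).inv ≫ C.str.appLE ⊤ C.affinePart le_top).hom

instance [Finite k] : Nonempty C.affinePart := ⟨⟨genericPoint C.X, C.genericPoint_ne⟩⟩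

/-- The normalized valuation `ord_∞` on `A`: the order of vanishing at `∞` of an element of `A`,
seen as a rational function on the curve. -/
def ordInfty [Finite k] (a : C.coordRing) : ℤ :=
  C.X.ord (C.X.germToFunctionField C.affinePart a) C.pt

/-- `deg(∞) = [κ(∞) : k]`. The residue field of the only point of `Spec k` is `k`. -/
def degInfty : ℕ := C.str.residueDegree C.pt

/-- `d(a) = - r · ord_∞(a) · deg(∞)`. This is nonnegative for `a ≠ 0`, since an element of `A` has
no poles outside `∞`, so that it cannot vanish at `∞` unless it is zero. -/
def tauDegree [Finite k] (r : ℕ) (a : C.coordRing) : ℕ :=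
  (-((r : ℤ) * C.ordInfty a * (C.degInfty : ℤ))).toNat

/-- A finite morphism `π : C' → C` of curves over `k` such that `∞'` is the only point of `C'`
above `∞`. -/
structure Cover (C' C : PointedCurve k) where
  hom : C'.X ⟶ C.X
  comp_str : hom ≫ C.str = C'.str
  finite : IsFinite hom
  hom_eq_pt_iff (x : C'.X) : hom x = C.pt ↔ x = C'.pt

namespace Cover

variable {C' C : PointedCurve k} (π : Cover C' C)

/-- The degree of the extension of function fields. The generic point of `C'` lies over the
generic point of `C`, and the residue field of a generic point is the function field. -/
def degree : ℕ := π.hom.residueDegree (genericPoint C'.X)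

theorem affinePart_le : C'.affinePart ≤ π.hom ⁻¹ᵁ C.affinePart := fun x hx h =>
  hx ((π.hom_eq_pt_iff x).mp h)

/-- The ring homomorphism `π^* : A → A'`. -/
def coordMap : C.coordRing ⟶ C'.coordRing :=
  π.hom.appLE C.affinePart C'.affinePart π.affinePart_le

end Cover

end PointedCurve

/-! ## Group schemes with an action of `A` -/

/-- For `c : S → Spec A`, the ring homomorphism `c^* : A → Γ(S, 𝒪)`. -/
def pullFn {A : CommRingCat.{u}} {S : Scheme.{u}} (c : S ⟶ Spec A) : A →+* Γ(S, ⊤) :=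
  ((Scheme.ΓSpecIso A).inv ≫ c.appTop).hom

/-- A pair `(E, φ)` of a commutative group scheme `E` over `S` and a ring homomorphism
`φ : A → End_S(E)`, through its functor of points: a functor `T ↦ E(T)` from `S`-schemes to
`A`-modules whose underlying functor to sets is representable by an `S`-scheme. By the Yoneda lemma
the group scheme structure is the same as a functorial structure of commutative group on the sets
`E(T)`, and the endomorphism `φ(a)` is `x ↦ a • x` on points. -/
structure ModuleScheme (A : CommRingCat.{u}) (S : Scheme.{u}) where
  points : (Over S)ᵒᵖ ⥤ ModuleCat.{u} A
  representable : (points ⋙ forget (ModuleCat.{u} A)).IsRepresentable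

namespace ModuleScheme

variable {A A' : CommRingCat.{u}} {S S' : Scheme.{u}}

/-- The pullback `(f^* E, f^* φ)` along `f : S' → S`, represented by `E ×_S S'`. -/
def pullback (E : ModuleScheme A S) (f : S' ⟶ S) : ModuleScheme A S' where
  points := (Over.map f).op ⋙ E.points
  representable := by
    have := E.representable
    let r := (E.points ⋙ forget (ModuleCat.{u} A)).representableBy
    exact (Functor.RepresentableBy.isRepresentable
      (Y := (Over.pullback f).obj (E.points ⋙ forget (ModuleCat.{u} A)).reprX)
      { homEquiv := fun {X} => ((Over.mapPullbackAdj f).homEquiv X _).symm.trans r.homEquiv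
        homEquiv_comp := fun {X X'} g h => by
          simp only [Equiv.trans_apply]
          rw [Adjunction.homEquiv_naturality_left_symm, r.homEquiv_comp]
          rfl })

/-- Restriction of coefficients `(E, φ') ↦ (E, φ' ∘ α)` along `α : A → A'`. -/
def restrictScalars (E : ModuleScheme A' S) (α : A ⟶ A') : ModuleScheme A S where
  points := E.points ⋙ ModuleCat.restrictScalars α.hom
  representable := E.representable

/-- There is an isomorphism of group schemes over `S` that commutes with the actions of `A`. -/
def Isomorphic (E E' : ModuleScheme A S) : Prop :=
  Nonempty (E.points ≅ E'.points)

end ModuleScheme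

/-- For `c : S → Spec A` and `j : U → S`, an isomorphism `ψ : E_U ≅ 𝔾_{a,U}` of `k`-linear group
schemes over `U`, through its action on points: on `T`-points, for a `U`-scheme `t : T → U`, it is
an additive bijection of `E(T)` with `𝔾_a(T) = Γ(T, 𝒪)`, functorial in `T`. Here `ζ : k` acts on
`E` through `ι : k → A`, and on `𝔾_a` by multiplication by `ζ`. For a Drinfeld module over a reduced
base every isomorphism of group schemes `E_U ≅ 𝔾_{a,U}` is `k`-linear: the expansion of a constant
`ζ` has degree `0` in `τ`, so that `ζ` acts as multiplication by `ζ` in any coordinate. -/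
structure GaIso {k : Type u} [Field k] {A : CommRingCat.{u}} (ι : k →+* A) {S U : Scheme.{u}}
    (c : S ⟶ Spec A) (E : ModuleScheme A S) (j : U ⟶ S) where
  toEquiv (T : Over S) (t : T.left ⟶ U) (ht : t ≫ j = T.hom) :
    E.points.obj (op T) ≃+ Γ(T.left, ⊤)
  naturality {T T' : Over S} (g : T' ⟶ T) (t : T.left ⟶ U) (ht : t ≫ j = T.hom)
    (ht' : (g.left ≫ t) ≫ j = T'.hom) (x : E.points.obj (op T)) :
    toEquiv T' (g.left ≫ t) ht' (E.points.map g.op x) = g.left.appTop (toEquiv T t ht x)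
  map_smul (T : Over S) (t : T.left ⟶ U) (ht : t ≫ j = T.hom) (ζ : k) (x : E.points.obj (op T)) :
    toEquiv T t ht (ι ζ • x) = pullFn (T.hom ≫ c) (ι ζ) * toEquiv T t ht x

/-- With `B = Γ(U, 𝒪)` and `q = #k`: the endomorphism `ψ ∘ φ(a) ∘ ψ⁻¹` of `𝔾_{a,U}` is of the form
`∑ δ_i τ^i ∈ B{τ}`, that is `y ↦ ∑ δ_i y ^ (q ^ i)`, with `δ_0 = c^*(a)`, `δ_d` a unit of `B`, and
`δ_i` nilpotent for `i > d`. -/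
def GaIso.HasExpansion {k : Type u} [Field k] {A : CommRingCat.{u}} {ι : k →+* A}
    {S U : Scheme.{u}} {c : S ⟶ Spec A} {E : ModuleScheme A S} {j : U ⟶ S}
    (ψ : GaIso ι c E j) (a : A) (d : ℕ) : Prop :=
  ∃ δ : ℕ →₀ Γ(U, ⊤),
    (∀ (T : Over S) (t : T.left ⟶ U) (ht : t ≫ j = T.hom) (x : E.points.obj (op T)),
      ψ.toEquiv T t ht (a • x) =
        δ.sum fun i b => t.appTop b * ψ.toEquiv T t ht x ^ (Nat.card k ^ i)) ∧
    δ 0 = pullFn (j ≫ c) a ∧ IsUnit (δ d) ∧ ∀ i, d < i → IsNilpotent (δ i)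

/-- The two conditions in the definition of a Drinfeld module of characteristic `c : S → Spec A`,
where `d : A → ℕ` prescribes the degrees in `τ`. -/
structure IsDrinfeld {k : Type u} [Field k] {A : CommRingCat.{u}} (ι : k →+* A) (d : A → ℕ)
    {S : Scheme.{u}} (c : S ⟶ Spec A) (E : ModuleScheme A S) : Prop where
  /-- `E` is Zariski locally on `S` isomorphic to `𝔾_a`. -/
  locallyGa (s : S) : ∃ U : S.Opens, s ∈ U ∧ Nonempty (GaIso ι c E U.ι)
  /-- For every affine open `U` of `S` and every isomorphism `E_U ≅ 𝔾_{a,U}`, the elements of `A`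
  act by twisted polynomials of the prescribed form. -/
  expansion (U : S.Opens) (hU : IsAffineOpen U) (ψ : GaIso ι c E U.ι) (a : A) (ha : a ≠ 0) :
    ψ.HasExpansion a (d a)

/-! ## Invariance under base change

The following facts on endomorphisms of `𝔾_a` show that the pullback of a Drinfeld module is a
Drinfeld module, which is needed in order to define the moduli functor. -/

section
open Polynomial

theorem primePow_of_dvd_choose {p m : ℕ} (hp : p.Prime) (hm : 0 < m)
    (h : ∀ i j : ℕ, 0 < i → 0 < j → i + j = m → p ∣ (i + j).choose j) : ∃ s, m = p ^ s := by
  have : Fact p.Prime := ⟨hp⟩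
  obtain ⟨s, m', hm', rfl⟩ := Nat.exists_eq_pow_mul_and_not_dvd hm.ne' p hp.ne_one
  refine ⟨s, ?_⟩
  have hps : 0 < p ^ s := pow_pos hp.pos s
  rcases Nat.lt_trichotomy m' 1 with h1 | h1 | h1
  · simp at h1; simp [h1] at hm
  · simp [h1]
  · exfalso
    have h2 := h (p ^ s * (m' - 1)) (p ^ s) (by have : 0 < m' - 1 := by omega
                                                positivity) hps (by
      rw [← Nat.mul_succ]; congr 1; omega)
    have h3 : p ^ s * (m' - 1) + p ^ s = p ^ s * m' := by
      rw [← Nat.mul_succ]; congr 1; omega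
    rw [h3] at h2
    have key : ∀ s : ℕ, (p ^ s * m').choose (p ^ s) ≡ m' [MOD p] := by
      intro s
      induction s with
      | zero => simp; rfl
      | succ s ih =>
        refine (Choose.choose_modEq_choose_mod_mul_choose_div_nat).trans ?_
        rw [pow_succ', mul_assoc, Nat.mul_mod_right, Nat.mul_mod_right, Nat.mul_div_cancel_left _ hp.pos,
          Nat.mul_div_cancel_left _ hp.pos]
        simpa using ih
    exact hm' ((key s).dvd_iff dvd_rfl |>.mp h2)

theorem coeff_eq_zero_of_additive {k : Type u} [Field k] [Finite k] {B : Type u} [CommRing B]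
    (κ : k →+* B) (F : B[X])
    (hadd : ∀ (D : Type u) [CommRing D] (f : B →+* D) (y z : D),
      F.eval₂ f (y + z) = F.eval₂ f y + F.eval₂ f z)
    (hmul : ∀ (D : Type u) [CommRing D] (f : B →+* D) (ζ : k) (y : D),
      F.eval₂ f (f (κ ζ) * y) = f (κ ζ) * F.eval₂ f y)
    (m : ℕ) (hm : F.coeff m ≠ 0) : ∃ i, m = Nat.card k ^ i := by
  have hB : Nontrivial B := nontrivial_of_ne _ _ hm
  cases nonempty_fintype k
  obtain ⟨p, _⟩ := CharP.exists k
  obtain ⟨e, hp, hq⟩ := FiniteField.card k p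
  rw [Nat.card_eq_fintype_card, hq]
  have : Fact p.Prime := ⟨hp⟩
  have : CharP B p := charP_of_injective_ringHom κ.injective p
  have hζ : ∀ ζ : k, ζ ^ m = ζ := fun ζ => by
    by_contra hne
    have h := congr(($(hmul B[X] C ζ X)).coeff m)
    have e1 : F.eval₂ C (C (κ ζ) * X) = F.comp (C (κ ζ) * X) := rfl
    have e2 : F.eval₂ C X = F := eval₂_C_X
    rw [e1, e2, comp_C_mul_X_coeff, coeff_C_mul, mul_comm, ← sub_eq_zero, ← sub_mul, ← map_pow,
      ← map_sub] at h
    have hu : IsUnit (κ (ζ ^ m - ζ)) := (IsUnit.mk0 _ (sub_ne_zero.mpr hne)).map κ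
    exact hm (hu.mul_right_eq_zero.mp h)
  have hch : ∀ i j : ℕ, 0 < i → 0 < j → i + j = m → p ∣ (i + j).choose j := fun i j hi hj hij => by
    have h := hadd B[X][X] (C.comp C) (C X) X
    have e1 : ∀ G : B[X], G.eval₂ (C.comp C) X = (G.map C : B[X][X]) := fun G => by
      rw [← eval₂_map, eval₂_C_X]
    have e2 : F.eval₂ ((C : B[X] →+* B[X][X]).comp C) (C X + X) = taylor X (F.map C) := by
      rw [← eval₂_map, taylor_apply, comp, add_comm]
    have e3 : F.eval₂ ((C : B[X] →+* B[X][X]).comp C) (C X) = C F := by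
      rw [← hom_eval₂, eval₂_C_X]
    rw [e1, e2, e3] at h
    have h' := congr((($h).coeff j).coeff i)
    have e4 : hasseDeriv j (F.map (C : B →+* B[X])) = (hasseDeriv j F).map C := by
      ext1 n; simp [hasseDeriv_coeff]
    rw [taylor_coeff, e4, Polynomial.eval_map, eval₂_C_X, hasseDeriv_coeff, coeff_add, coeff_C,
      if_neg hj.ne', zero_add, coeff_map, coeff_C, if_neg hi.ne', hij] at h'
    rw [hij]
    by_contra hnd
    have hu : IsUnit ((m.choose j : ℕ) : B) := by
      have : ((m.choose j : ℕ) : k) ≠ 0 := fun h0 => hnd ((CharP.cast_eq_zero_iff k p _).mp h0)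
      simpa using (IsUnit.mk0 _ this).map κ
    exact hm (hu.mul_right_eq_zero.mp h')
  have hm0 : 0 < m := by
    rcases Nat.eq_zero_or_pos m with rfl | h
    · have := hadd B (RingHom.id B) 0 0
      simp at this
      exact absurd this hm
    · exact h
  obtain ⟨s, rfl⟩ := primePow_of_dvd_choose hp hm0 hch
  have hdvd : Fintype.card k - 1 ∣ p ^ s - 1 := by
    rw [← FiniteField.forall_pow_eq_one_iff]
    intro x
    have h1 : x ^ (p ^ s - 1) * x = x := by
      rw [← pow_succ, Nat.sub_add_cancel hm0]
      ext; simp [hζ]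
    simpa using h1
  rw [hq] at hdvd
  have hg := Nat.pow_sub_one_gcd_pow_sub_one p e s
  rw [Nat.gcd_eq_left hdvd] at hg
  have h5 : p ^ (e : ℕ) = p ^ (e : ℕ).gcd s := by
    have := Nat.pow_pos (n := e) hp.pos
    have := Nat.pow_pos (n := (e : ℕ).gcd s) hp.pos
    omega
  have h6 := Nat.pow_right_injective hp.two_le h5
  obtain ⟨i, hi⟩ := Nat.gcd_eq_left_iff_dvd.mp h6.symm
  exact ⟨i, by rw [hi, pow_mul]⟩

theorem comp_coeff_one {B : Type u} [CommRing B] {F P v w : B[X]} (h : F.comp v = v.comp P)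
    (hvw : v.comp w = X) (hv : v.coeff 0 = 0) (hw : w.coeff 0 = 0) (hP : P.coeff 0 = 0) :
    F.coeff 1 = P.coeff 1 := by
  have h1 := congr((derivative $h).eval 0)
  have h2 := congr((derivative $hvw).eval 0)
  rw [coeff_zero_eq_eval_zero] at hv hw hP
  simp only [derivative_comp, eval_mul, eval_comp, hv, hw, hP, derivative_X, eval_one] at h1 h2
  have hF : ∀ G : B[X], (derivative G).eval 0 = G.coeff 1 := fun G => by
    rw [← coeff_zero_eq_eval_zero, coeff_derivative]; simp
  rw [hF, hF, hF] at *
  linear_combination (w.coeff 1) * h1 - (F.coeff 1 - P.coeff 1) * h2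

theorem comp_coeff_eq_zero_iff {B : Type u} [CommRing B] [IsDomain B] {F P v w : B[X]}
    (h : F.comp v = v.comp P) (hvw : v.comp w = X) (hv : v.coeff 0 = 0) (i : ℕ) :
    F.coeff i = 0 ↔ P.coeff i = 0 := by
  have h1 := congr(natDegree $hvw)
  rw [natDegree_comp, natDegree_X] at h1
  have hd : v.natDegree = 1 := Nat.eq_one_of_mul_eq_one_right h1
  have hv' : v = C (v.coeff 1) * X := by
    rw [v.as_sum_range_C_mul_X_pow, hd]
    simp [Finset.sum_range_succ, hv]
  have h0 : v.coeff 1 ≠ 0 := by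
    rw [← hd]; exact leadingCoeff_ne_zero.mpr (by rintro rfl; simp at hd)
  rw [hv'] at h
  have h2 := congr(($h).coeff i)
  rw [comp_C_mul_X_coeff, mul_comp, C_comp, X_comp, coeff_C_mul] at h2
  constructor
  · intro hF; rw [hF, zero_mul] at h2
    exact (mul_eq_zero.mp h2.symm).resolve_left h0
  · intro hP; rw [hP, mul_zero] at h2
    exact (mul_eq_zero.mp h2).resolve_right (pow_ne_zero _ h0)

/-- the polynomial of a twisted polynomial -/
def tauPoly {B : Type u} [CommRing B] (q : ℕ) (δ : ℕ →₀ B) : B[X] :=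
  δ.sum fun i b => C b * X ^ q ^ i

theorem tauPoly_coeff {B : Type u} [CommRing B] {q : ℕ} (hq : 2 ≤ q) (δ : ℕ →₀ B) (i : ℕ) :
    (tauPoly q δ).coeff (q ^ i) = δ i := by
  rw [tauPoly, Finsupp.sum, finsetSum_coeff]
  simp only [coeff_C_mul, coeff_X_pow, (Nat.pow_right_injective hq).eq_iff]
  simp [eq_comm]

theorem tauPoly_coeff_zero {B : Type u} [CommRing B] {q : ℕ} (hq : 2 ≤ q) (δ : ℕ →₀ B) :
    (tauPoly q δ).coeff 0 = 0 := by
  rw [tauPoly, Finsupp.sum, finsetSum_coeff]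
  refine Finset.sum_eq_zero fun i _ => ?_
  rw [coeff_C_mul, coeff_X_pow, if_neg (pow_pos (by omega) i).ne, mul_zero]

theorem tauPoly_eval₂ {B D : Type u} [CommRing B] [CommRing D] (q : ℕ) (δ : ℕ →₀ B)
    (f : B →+* D) (y : D) : (tauPoly q δ).eval₂ f y = δ.sum fun i b => f b * y ^ q ^ i := by
  simp [tauPoly, Finsupp.sum, eval₂_finsetSum]

theorem exists_tauPoly {B : Type u} [CommRing B] {q : ℕ} (hq : 2 ≤ q) (F : B[X])
    (h : ∀ m, F.coeff m ≠ 0 → ∃ i, m = q ^ i) : ∃ δ : ℕ →₀ B, F = tauPoly q δ := by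
  refine ⟨Finsupp.onFinset (Finset.range (F.natDegree + 1)) (fun i => F.coeff (q ^ i))
    fun i hi => ?_, ?_⟩
  · have := le_natDegree_of_ne_zero hi
    have := Nat.lt_pow_self (n := i) (a := q) (by omega)
    simp; omega
  · ext m
    by_cases hm : ∃ i, m = q ^ i
    · obtain ⟨i, rfl⟩ := hm
      rw [tauPoly_coeff hq]; rfl
    · rw [not_imp_comm.mp (h m) hm, tauPoly, Finsupp.sum, finsetSum_coeff]
      refine (Finset.sum_eq_zero fun i _ => ?_).symm
      rw [coeff_C_mul, coeff_X_pow, if_neg fun e => hm ⟨i, e⟩, mul_zero]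
end

section
variable {k : Type u} [Field k] {A : CommRingCat.{u}} {ι : k →+* A}
    {S U V : Scheme.{u}} {c : S ⟶ Spec A} {E : ModuleScheme A S} {j : U ⟶ S}

theorem appTop_comp_apply {X Y Z : Scheme.{u}} (f : X ⟶ Y) (g : Y ⟶ Z) (b : Γ(Z, ⊤)) :
    (f ≫ g).appTop b = f.appTop (g.appTop b) := by
  rw [Scheme.Hom.comp_appTop]; rfl

theorem pullFn_comp {S S' : Scheme.{u}} (f : S' ⟶ S) (c : S ⟶ Spec A) (a : A) :
    pullFn (f ≫ c) a = f.appTop (pullFn c a) := by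
  simp only [pullFn, Scheme.Hom.comp_appTop]; rfl

namespace GaIso

def restrict (ψ : GaIso ι c E j) (h : V ⟶ U) (j' : V ⟶ S) (e : h ≫ j = j') :
    GaIso ι c E j' where
  toEquiv T t ht := ψ.toEquiv T (t ≫ h) (by rw [Category.assoc, e, ht])
  naturality g t ht ht' x := by
    simpa only [Category.assoc] using ψ.naturality g (t ≫ h) (by rw [Category.assoc, e, ht])
      (by simpa [e] using ht') x
  map_smul T t ht ζ x := ψ.map_smul T _ _ ζ x

def pullback (ψ : GaIso ι c E j) {S' : Scheme.{u}} (f : S' ⟶ S) (h : V ⟶ U) (j' : V ⟶ S')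
    (e : h ≫ j = j' ≫ f) : GaIso ι (f ≫ c) (E.pullback f) j' where
  toEquiv T t ht := ψ.toEquiv ((Over.map f).obj T) (t ≫ h)
    (by rw [Category.assoc, e, reassoc_of% ht]; rfl)
  naturality {T T'} g t ht ht' x := by
    have h1 := ψ.naturality ((Over.map f).map g) (t ≫ h)
      (by rw [Category.assoc, e, reassoc_of% ht]; rfl)
      (by simp only [Over.map_map_left, Category.assoc, e]
          simp only [Category.assoc] at ht'
          rw [reassoc_of% ht']; rfl) x
    simp only [Category.assoc]
    exact h1
  map_smul T t ht ζ x := by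
    have := ψ.map_smul ((Over.map f).obj T) (t ≫ h)
      (by rw [Category.assoc, e, reassoc_of% ht]; rfl) ζ x
    simp only [Over.map_obj_hom, Category.assoc] at this
    exact this

theorem HasExpansion.pull {S' : Scheme.{u}} {c' : S' ⟶ Spec A} {E' : ModuleScheme A S'}
    {j' : V ⟶ S'} {ψ : GaIso ι c E j} {ψ' : GaIso ι c' E' j'} {a : A} {d : ℕ}
    (H : ψ.HasExpansion a d) (h : V ⟶ U) (hc : j' ≫ c' = h ≫ j ≫ c)
    (hψ : ∀ (δ : ℕ →₀ Γ(U, ⊤)), (∀ (T : Over S) (t : T.left ⟶ U) (ht : t ≫ j = T.hom)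
        (x : E.points.obj (op T)), ψ.toEquiv T t ht (a • x) =
        δ.sum fun i b => t.appTop b * ψ.toEquiv T t ht x ^ (Nat.card k ^ i)) →
      (∀ (T : Over S') (t : T.left ⟶ V) (ht : t ≫ j' = T.hom)
        (x : E'.points.obj (op T)), ψ'.toEquiv T t ht (a • x) =
        δ.sum fun i b => (t ≫ h).appTop b * ψ'.toEquiv T t ht x ^ (Nat.card k ^ i))) :
    ψ'.HasExpansion a d := by
  obtain ⟨δ, h1, h2, h3, h4⟩ := H
  refine ⟨δ.mapRange h.appTop (map_zero _), fun T t ht x => ?_, ?_, ?_, fun i hi => ?_⟩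
  · rw [hψ δ h1 T t ht x, Finsupp.sum_mapRange_index (by simp)]
    simp only [appTop_comp_apply]
  · rw [hc, pullFn_comp, ← h2]; simp
  · simpa using h3.map h.appTop.hom
  · simpa using (h4 i hi).map h.appTop.hom

theorem HasExpansion.restrict {ψ : GaIso ι c E j} {a : A} {d : ℕ} (H : ψ.HasExpansion a d)
    (h : V ⟶ U) (j' : V ⟶ S) (e : h ≫ j = j') : (ψ.restrict h j' e).HasExpansion a d :=
  H.pull h (by rw [← e, Category.assoc]) fun _ h1 T t _ x => h1 T (t ≫ h) _ x

theorem HasExpansion.pullback {ψ : GaIso ι c E j} {a : A} {d : ℕ} (H : ψ.HasExpansion a d)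
    {S' : Scheme.{u}} (f : S' ⟶ S) (h : V ⟶ U) (j' : V ⟶ S') (e : h ≫ j = j' ≫ f) :
    (ψ.pullback f h j' e).HasExpansion a d :=
  H.pull h (by rw [reassoc_of% e]) fun _ h1 T t _ x => h1 ((Over.map f).obj T) (t ≫ h) _ x


section poly
open Polynomial

theorem polyPoint {U T : Scheme.{u}} [IsAffine U] (t : T ⟶ U) (y : Γ(T, ⊤)) :
    ∃ g : T ⟶ Spec (.of Γ(U, ⊤)[X]), g ≫ Spec.map (CommRingCat.ofHom C) ≫ U.isoSpec.inv = t ∧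
      ∀ F : Γ(U, ⊤)[X], g.appTop ((Scheme.ΓSpecIso (.of Γ(U, ⊤)[X])).inv F) =
        F.eval₂ t.appTop.hom y := by
  refine ⟨T.toSpecΓ ≫ Spec.map (CommRingCat.ofHom (eval₂RingHom t.appTop.hom y)), ?_, fun F => ?_⟩
  · have : CommRingCat.ofHom C ≫ CommRingCat.ofHom (eval₂RingHom t.appTop.hom y) = t.appTop := by
      ext b; simp
    rw [Category.assoc, ← Spec.map_comp_assoc, this, ← Scheme.toSpecΓ_naturality_assoc,
      Scheme.toSpecΓ_isoSpec_inv, Category.comp_id]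
  · have h := Scheme.ΓSpecIso_inv_naturality (CommRingCat.ofHom (eval₂RingHom t.appTop.hom y))
    have h2 : (CommRingCat.ofHom (eval₂RingHom t.appTop.hom y)) =
      (Scheme.ΓSpecIso (.of Γ(U, ⊤)[X])).inv ≫ (T.toSpecΓ ≫
        Spec.map (CommRingCat.ofHom (eval₂RingHom t.appTop.hom y))).appTop := by
      rw [Scheme.Hom.comp_appTop, ← reassoc_of% h, Scheme.toSpecΓ_appTop]
      simp
    exact (congr($(h2) F)).symm

theorem isoSpec_inv_appTop' (U : Scheme.{u}) [IsAffine U] :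
    U.isoSpec.inv.appTop = (Scheme.ΓSpecIso Γ(U, ⊤)).inv := by
  have h2 : U.isoSpec.hom.appTop = (Scheme.ΓSpecIso Γ(U, ⊤)).hom := U.toSpecΓ_appTop
  have h3 : U.isoSpec.inv.appTop ≫ U.isoSpec.hom.appTop = 𝟙 _ := by
    rw [← Scheme.Hom.comp_appTop, Iso.hom_inv_id]; simp
  rw [h2] at h3
  rw [← cancel_mono (Scheme.ΓSpecIso Γ(U, ⊤)).hom, h3, Iso.inv_hom_id]

theorem eval₂_X_point {U : Scheme.{u}} [IsAffine U] (F : Γ(U, ⊤)[X]) :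
    F.eval₂ (Spec.map (CommRingCat.ofHom C) ≫ U.isoSpec.inv).appTop.hom
      ((Scheme.ΓSpecIso (.of Γ(U, ⊤)[X])).inv X) = (Scheme.ΓSpecIso (.of Γ(U, ⊤)[X])).inv F := by
  have h1 := isoSpec_inv_appTop' U
  have : eval₂RingHom (Spec.map (CommRingCat.ofHom C) ≫ U.isoSpec.inv).appTop.hom
      ((Scheme.ΓSpecIso (.of Γ(U, ⊤)[X])).inv X) =
      (Scheme.ΓSpecIso (.of Γ(U, ⊤)[X])).inv.hom := by
    refine Polynomial.ringHom_ext' ?_ (by simp)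
    have h : (Scheme.ΓSpecIso Γ(U, ⊤)).inv ≫ (Spec.map (CommRingCat.ofHom C)).appTop =
        CommRingCat.ofHom C ≫ (Scheme.ΓSpecIso (.of Γ(U, ⊤)[X])).inv :=
      (Scheme.ΓSpecIso_inv_naturality (CommRingCat.ofHom (C (R := Γ(U, ⊤))))).symm
    rw [Scheme.Hom.comp_appTop, h1, h]
    ext b
    exact eval₂_C _ _
  exact congr($(this) F)

theorem exists_poly {U : Scheme.{u}} [IsAffine U]
    (Φ : ∀ (T : Scheme.{u}) (_ : T ⟶ U), Γ(T, ⊤) → Γ(T, ⊤))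
    (hΦ : ∀ (T T' : Scheme.{u}) (t : T ⟶ U) (g : T' ⟶ T) (y : Γ(T, ⊤)),
      Φ T' (g ≫ t) (g.appTop y) = g.appTop (Φ T t y)) :
    ∃ F : Γ(U, ⊤)[X], ∀ (T : Scheme.{u}) (t : T ⟶ U) (y : Γ(T, ⊤)),
      Φ T t y = F.eval₂ t.appTop.hom y := by
  let T₀ : Scheme.{u} := Spec (.of Γ(U, ⊤)[X])
  let i := Scheme.ΓSpecIso (.of Γ(U, ⊤)[X])
  refine ⟨i.hom (Φ T₀ (Spec.map (CommRingCat.ofHom C) ≫ U.isoSpec.inv) (i.inv X)), fun T t y => ?_⟩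
  obtain ⟨g, hg, h⟩ := polyPoint t y
  rw [← h]
  have h2 := hΦ T₀ T (Spec.map (CommRingCat.ofHom C) ≫ U.isoSpec.inv) g (i.inv X)
  rw [hg, h] at h2
  simpa [i] using h2

theorem poly_ext {U : Scheme.{u}} [IsAffine U] (F G : Γ(U, ⊤)[X])
    (h : ∀ (T : Scheme.{u}) (t : T ⟶ U) (y : Γ(T, ⊤)),
      F.eval₂ t.appTop.hom y = G.eval₂ t.appTop.hom y) : F = G := by
  have h1 := h (Spec (.of Γ(U, ⊤)[X])) (Spec.map (CommRingCat.ofHom C) ≫ U.isoSpec.inv)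
    ((Scheme.ΓSpecIso (.of Γ(U, ⊤)[X])).inv X)
  rw [eval₂_X_point, eval₂_X_point] at h1
  exact (Scheme.ΓSpecIso (.of Γ(U, ⊤)[X])).symm.commRingCatIsoToRingEquiv.injective h1


/-- coordinates on the points over `T → U`. -/
def at' (ψ : GaIso ι c E j) {T : Scheme.{u}} (t : T ⟶ U) :
    E.points.obj (op (Over.mk (t ≫ j))) ≃+ Γ(T, ⊤) :=
  ψ.toEquiv (Over.mk (t ≫ j)) t rfl

theorem at'_naturality (ψ : GaIso ι c E j) {T T' : Scheme.{u}} (g : T' ⟶ T) (t : T ⟶ U)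
    (x : E.points.obj (op (Over.mk (t ≫ j)))) :
    ψ.at' (g ≫ t) ((E.points.map (Over.homMk (U := Over.mk ((g ≫ t) ≫ j))
      (V := Over.mk (t ≫ j)) g (by simp)).op).hom x) = g.appTop (ψ.at' t x) :=
  ψ.naturality (T := Over.mk (t ≫ j)) (T' := Over.mk ((g ≫ t) ≫ j))
        (Over.homMk g (by simp)) t rfl rfl x

theorem exists_actPoly [IsAffine U] (ψ ψ' : GaIso ι c E j) (a : A) :
    ∃ F : Γ(U, ⊤)[X], ∀ (T : Over S) (t : T.left ⟶ U) (ht : t ≫ j = T.hom)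
      (x : E.points.obj (op T)),
      ψ'.toEquiv T t ht (a • x) = F.eval₂ t.appTop.hom (ψ.toEquiv T t ht x) := by
  obtain ⟨F, hF⟩ := exists_poly (U := U) (fun T t y => ψ'.at' t (a • (ψ.at' t).symm y))
    fun T T' t g y => by
      obtain ⟨x, rfl⟩ := (ψ.at' t).surjective y
      rw [AddEquiv.symm_apply_apply, ← at'_naturality, ← at'_naturality, AddEquiv.symm_apply_apply,
        LinearMap.map_smul]
  refine ⟨F, fun T t ht x => ?_⟩
  obtain ⟨X, ⟨⟨⟩⟩, f⟩ := T
  change X ⟶ S at f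
  change X ⟶ U at t
  have ht' : t ≫ j = f := ht
  subst ht'
  have := hF X t (ψ.at' t x)
  rwa [AddEquiv.symm_apply_apply] at this

theorem exists_compare [IsAffine U] (ψ ψ' : GaIso ι c E j) {a : A} {F P : Γ(U, ⊤)[X]}
    (hP : ∀ (T : Over S) (t : T.left ⟶ U) (ht : t ≫ j = T.hom)
      (x : E.points.obj (op T)),
      ψ.toEquiv T t ht (a • x) = P.eval₂ t.appTop.hom (ψ.toEquiv T t ht x))
    (hF : ∀ (T : Over S) (t : T.left ⟶ U) (ht : t ≫ j = T.hom)
      (x : E.points.obj (op T)),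
      ψ'.toEquiv T t ht (a • x) = F.eval₂ t.appTop.hom (ψ'.toEquiv T t ht x)) :
    ∃ v w : Γ(U, ⊤)[X], F.comp v = v.comp P ∧ v.comp w = X ∧ v.coeff 0 = 0 ∧ w.coeff 0 = 0 := by
  obtain ⟨v, hv⟩ := exists_actPoly ψ ψ' 1
  obtain ⟨w, hw⟩ := exists_actPoly ψ' ψ 1
  simp only [one_smul] at hv hw
  have h0 : ∀ (ψ ψ' : GaIso ι c E j) (v : Γ(U, ⊤)[X]), (∀ (T : Over S) (t : T.left ⟶ U)
      (ht : t ≫ j = T.hom) (x : E.points.obj (op T)),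
      ψ'.toEquiv T t ht x = v.eval₂ t.appTop.hom (ψ.toEquiv T t ht x)) → v.coeff 0 = 0 := by
    intro ψ ψ' v hv
    have := hv (Over.mk (𝟙 U ≫ j)) (𝟙 U) rfl 0
    simpa using this.symm
  have hv' : ∀ (T : Scheme.{u}) (t : T ⟶ U) x, ψ'.at' t x = v.eval₂ t.appTop.hom (ψ.at' t x) :=
    fun T t x => hv (Over.mk (t ≫ j)) t rfl x
  have hw' : ∀ (T : Scheme.{u}) (t : T ⟶ U) x, ψ.at' t x = w.eval₂ t.appTop.hom (ψ'.at' t x) :=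
    fun T t x => hw (Over.mk (t ≫ j)) t rfl x
  have hP' : ∀ (T : Scheme.{u}) (t : T ⟶ U) x,
      ψ.at' t (a • x) = P.eval₂ t.appTop.hom (ψ.at' t x) := fun T t x => hP (Over.mk (t ≫ j)) t rfl x
  have hF' : ∀ (T : Scheme.{u}) (t : T ⟶ U) x,
      ψ'.at' t (a • x) = F.eval₂ t.appTop.hom (ψ'.at' t x) := fun T t x => hF (Over.mk (t ≫ j)) t rfl x
  refine ⟨v, w, poly_ext _ _ fun T t y => ?_, poly_ext _ _ fun T t y => ?_, h0 _ _ _ hv, h0 _ _ _ hw⟩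
  · obtain ⟨x, rfl⟩ := (ψ.at' t).surjective y
    rw [eval₂_comp, eval₂_comp, ← hv', ← hF', ← hP', ← hv']
  · obtain ⟨x, rfl⟩ := (ψ'.at' t).surjective y
    rw [eval₂_comp, ← hw', ← hv', eval₂_X]

theorem actPoly_restrict (ψ : GaIso ι c E j) {a : A} {F : Γ(U, ⊤)[X]}
    (hF : ∀ (T : Over S) (t : T.left ⟶ U) (ht : t ≫ j = T.hom) (x : E.points.obj (op T)),
      ψ.toEquiv T t ht (a • x) = F.eval₂ t.appTop.hom (ψ.toEquiv T t ht x))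
    (h : V ⟶ U) (j' : V ⟶ S) (e : h ≫ j = j')
    (T : Over S) (t : T.left ⟶ V) (ht : t ≫ j' = T.hom) (x : E.points.obj (op T)) :
    (ψ.restrict h j' e).toEquiv T t ht (a • x) =
      (F.map h.appTop.hom).eval₂ t.appTop.hom ((ψ.restrict h j' e).toEquiv T t ht x) := by
  rw [eval₂_map]
  have := hF T (t ≫ h) (by rw [Category.assoc, e, ht]) x
  rw [Scheme.Hom.comp_appTop] at this
  exact this

theorem tauPoly_of_actPoly [Finite k] [IsAffine U] (ψ : GaIso ι c E j) {a : A} {F : Γ(U, ⊤)[X]}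
    (hF : ∀ (T : Over S) (t : T.left ⟶ U) (ht : t ≫ j = T.hom) (x : E.points.obj (op T)),
      ψ.toEquiv T t ht (a • x) = F.eval₂ t.appTop.hom (ψ.toEquiv T t ht x)) :
    ∃ δ : ℕ →₀ Γ(U, ⊤), F = tauPoly (Nat.card k) δ := by
  have hF' : ∀ (T : Scheme.{u}) (t : T ⟶ U) x,
      ψ.at' t (a • x) = F.eval₂ t.appTop.hom (ψ.at' t x) :=
    fun T t x => hF (Over.mk (t ≫ j)) t rfl x
  have hs : ∀ (T : Scheme.{u}) (t : T ⟶ U) (ζ : k) x,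
      ψ.at' t (ι ζ • x) = t.appTop (pullFn (j ≫ c) (ι ζ)) * ψ.at' t x := fun T t ζ x => by
    rw [← pullFn_comp, ← Category.assoc]
    exact ψ.map_smul (Over.mk (t ≫ j)) t rfl ζ x
  -- every ring over `Γ(U)` gives a `U`-scheme
  have hring : ∀ (D : Type u) [CommRing D] (f : Γ(U, ⊤) →+* D), ∃ (t : Spec (.of D) ⟶ U),
      t.appTop = CommRingCat.ofHom f ≫ (Scheme.ΓSpecIso (.of D)).inv := fun D _ f => by
    refine ⟨Spec.map (CommRingCat.ofHom f) ≫ U.isoSpec.inv, ?_⟩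
    rw [Scheme.Hom.comp_appTop, isoSpec_inv_appTop']
    exact (Scheme.ΓSpecIso_inv_naturality (CommRingCat.ofHom f)).symm
  have hev : ∀ (D : Type u) [CommRing D] (f : Γ(U, ⊤) →+* D) (t : Spec (.of D) ⟶ U),
      t.appTop = CommRingCat.ofHom f ≫ (Scheme.ΓSpecIso (.of D)).inv → ∀ y : D,
      F.eval₂ t.appTop.hom ((Scheme.ΓSpecIso (.of D)).inv y) =
        (Scheme.ΓSpecIso (.of D)).inv (F.eval₂ f y) := fun D _ f t ht y => by
    rw [ht, CommRingCat.hom_comp, CommRingCat.hom_ofHom]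
    exact (hom_eval₂ F f (Scheme.ΓSpecIso (.of D)).inv.hom y).symm
  have hinj : ∀ (D : Type u) [CommRing D], Function.Injective (Scheme.ΓSpecIso (.of D)).inv :=
    fun D _ => (Scheme.ΓSpecIso (.of D)).symm.commRingCatIsoToRingEquiv.injective
  refine exists_tauPoly Finite.one_lt_card F
    (coeff_eq_zero_of_additive ((pullFn (j ≫ c)).comp ι) F ?_ ?_)
  · intro D _ f y z
    obtain ⟨t, ht⟩ := hring D f
    apply hinj
    rw [map_add, ← hev D f t ht, ← hev D f t ht, ← hev D f t ht, map_add]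
    obtain ⟨y', hy⟩ := (ψ.at' t).surjective ((Scheme.ΓSpecIso (.of D)).inv y)
    obtain ⟨z', hz⟩ := (ψ.at' t).surjective ((Scheme.ΓSpecIso (.of D)).inv z)
    rw [← hy, ← hz, ← map_add, ← hF', ← hF', ← hF', smul_add, map_add]
  · intro D _ f ζ y
    obtain ⟨t, ht⟩ := hring D f
    apply hinj
    obtain ⟨y', hy⟩ := (ψ.at' t).surjective ((Scheme.ΓSpecIso (.of D)).inv y)
    have hζ : (Scheme.ΓSpecIso (.of D)).inv (f (pullFn (j ≫ c) (ι ζ))) =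
        t.appTop (pullFn (j ≫ c) (ι ζ)) := by rw [ht]; rfl
    rw [map_mul, ← hev D f t ht, ← hev D f t ht, map_mul, RingHom.comp_apply, hζ, ← hy, ← hs, ← hF',
      ← hF', ← hs, smul_comm]

theorem fromSpecStalk_appTop' (X : Scheme.{u}) (x : X) :
    (X.fromSpecStalk x).appTop =
      X.presheaf.germ ⊤ x trivial ≫ (Scheme.ΓSpecIso (X.presheaf.stalk x)).inv := by
  rw [Scheme.fromSpecStalk_appTop]
  have : (Spec (X.presheaf.stalk x)).presheaf.map
      (homOfLE (le_top : (⊤ : (Spec (X.presheaf.stalk x)).Opens) ≤ ⊤)).op = 𝟙 _ :=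
    (Spec (X.presheaf.stalk x)).presheaf.map_id _
  erw [this, Category.comp_id]

theorem HasExpansion.of_locally [Finite k] [IsAffine U] (ψ' : GaIso ι c E j) (a : A) (d : ℕ)
    (H : ∀ x : U, ∃ W : S.Opens, j x ∈ W ∧ ∃ ψ : GaIso ι c E W.ι, ψ.HasExpansion a d) :
    ψ'.HasExpansion a d := by
  have hq : 2 ≤ Nat.card k := Finite.one_lt_card
  obtain ⟨F, hF⟩ := exists_actPoly ψ' ψ' a
  obtain ⟨δ, rfl⟩ := tauPoly_of_actPoly ψ' hF
  -- comparison on an affine scheme over a neighbourhood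
  have key : ∀ (x : U) (V : Scheme.{u}) (_ : IsAffine V) (g : V ⟶ U) (_ : ∀ y, g y ⤳ x),
      ∃ δ₁ : ℕ →₀ Γ(V, ⊤), δ₁ 0 = pullFn (g ≫ j ≫ c) a ∧ IsUnit (δ₁ d) ∧
        (∀ i, d < i → IsNilpotent (δ₁ i)) ∧
        g.appTop (δ 0) = δ₁ 0 ∧ (IsDomain Γ(V, ⊤) → ∀ i, g.appTop (δ i) = 0 ↔ δ₁ i = 0) := by
    intro x V _ g hg
    obtain ⟨W, hxW, ψ, hψ⟩ := H x
    have hr : Set.range (g ≫ j) ⊆ Set.range W.ι := by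
      rintro _ ⟨y, rfl⟩
      rw [Scheme.Opens.range_ι]
      exact ((hg y).map j.continuous).mem_open W.isOpen hxW
    obtain ⟨δ₁, h1, h2, h3, h4⟩ := hψ.restrict (IsOpenImmersion.lift W.ι (g ≫ j) hr) (g ≫ j)
      (IsOpenImmersion.lift_fac _ _ _)
    have h1' : ∀ (T : Over S) (t : T.left ⟶ V) (ht : t ≫ g ≫ j = T.hom) (x : E.points.obj (op T)),
        (ψ.restrict (IsOpenImmersion.lift W.ι (g ≫ j) hr) (g ≫ j)
          (IsOpenImmersion.lift_fac _ _ _)).toEquiv T t ht (a • x) =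
        (tauPoly (Nat.card k) δ₁).eval₂ t.appTop.hom ((ψ.restrict
          (IsOpenImmersion.lift W.ι (g ≫ j) hr) (g ≫ j)
          (IsOpenImmersion.lift_fac _ _ _)).toEquiv T t ht x) := fun T t ht x => by
      rw [tauPoly_eval₂]; exact h1 T t ht x
    obtain ⟨v, w, e1, e2, e3, e4⟩ := exists_compare _ _ h1'
      (actPoly_restrict ψ' hF g (g ≫ j) rfl)
    have c0 := comp_coeff_one e1 e2 e3 e4 (tauPoly_coeff_zero hq δ₁)
    rw [coeff_map, ← pow_zero (Nat.card k), tauPoly_coeff hq, tauPoly_coeff hq] at c0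
    refine ⟨δ₁, by simpa using h2, h3, h4, c0, fun _ i => ?_⟩
    have ci := comp_coeff_eq_zero_iff e1 e2 e3 (Nat.card k ^ i)
    rw [coeff_map, tauPoly_coeff hq, tauPoly_coeff hq] at ci
    exact ci
  have hpt : ∀ x : U, ((U.evaluation ⊤ x trivial (δ d) ≠ 0) ∧
      ∀ i, d < i → U.evaluation ⊤ x trivial (δ i) = 0) := by
    intro x
    obtain ⟨δ₁, -, h3, h4, -, h5⟩ := key x _ inferInstance (U.fromSpecResidueField x)
      (fun y => by rw [Scheme.fromSpecResidueField_apply])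
    have : IsDomain Γ(Spec (U.residueField x), ⊤) := inferInstance
    have h6 : ∀ b, (U.fromSpecResidueField x).appTop b =
        (Scheme.ΓSpecIso _).inv (U.evaluation ⊤ x trivial b) := fun b => by
      have e1 := Scheme.ΓSpecIso_inv_naturality (U.residue x)
      have e2 : (U.fromSpecResidueField x).appTop =
          U.evaluation ⊤ x trivial ≫ (Scheme.ΓSpecIso _).inv := by
        rw [Scheme.fromSpecResidueField, Scheme.Hom.comp_appTop, fromSpecStalk_appTop',
          Category.assoc, ← e1, ← Category.assoc]
        rfl
      exact congr($(e2) b)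
    have h7 : ∀ b, (U.fromSpecResidueField x).appTop b = 0 ↔ U.evaluation ⊤ x trivial b = 0 :=
      fun b => by
        rw [h6, map_eq_zero_iff]
        exact (Scheme.ΓSpecIso _).symm.commRingCatIsoToRingEquiv.injective
    refine ⟨fun h => ?_, fun i hi => ?_⟩
    · rw [← h7, h5 this] at h
      exact h3.ne_zero h
    · rw [← h7, h5 this]
      exact (h4 i hi).eq_zero
  refine ⟨δ, fun T t ht x => ?_, ?_, ?_, fun i hi => ?_⟩
  · rw [hF, tauPoly_eval₂]
  · refine TopCat.Presheaf.section_ext U.sheaf ⊤ _ _ fun x hx => ?_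
    obtain ⟨δ₁, h2, -, -, h5, -⟩ := key x _ inferInstance (U.fromSpecStalk x) (fun y => by
      have := U.range_fromSpecStalk (x := x)
      exact this.le ⟨y, rfl⟩)
    rw [h2, pullFn_comp, fromSpecStalk_appTop'] at h5
    exact (Scheme.ΓSpecIso (U.presheaf.stalk x)).symm.commRingCatIsoToRingEquiv.injective h5
  · refine RingedSpace.isUnit_of_isUnit_germ U.toLocallyRingedSpace.toRingedSpace ⊤ _
      fun x hx => ?_
    exact (Scheme.mem_basicOpen_top _ _ _).mp
      ((Scheme.evaluation_ne_zero_iff_mem_basicOpen _ _ _ _).mp (hpt x).1)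
  · rw [Scheme.isNilpotent_iff_basicOpen_eq_bot, Scheme.basicOpen_eq_bot_iff_forall_evaluation_eq_zero]
    exact fun x => (hpt x).2 i hi
end poly
end GaIso

theorem IsDrinfeld.pullback [Finite k] {d : A → ℕ} (H : IsDrinfeld ι d c E) {S' : Scheme.{u}}
    (f : S' ⟶ S) : IsDrinfeld ι d (f ≫ c) (E.pullback f) where
  locallyGa s := by
    obtain ⟨U, hU, ⟨ψ⟩⟩ := H.locallyGa (f s)
    exact ⟨f ⁻¹ᵁ U, hU, ⟨ψ.pullback f (f ∣_ U) (f ⁻¹ᵁ U).ι (morphismRestrict_ι f U)⟩⟩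
  expansion U hU ψ' a ha := by
    have : IsAffine U := hU
    refine GaIso.HasExpansion.of_locally ψ' a (d a) fun x => ?_
    obtain ⟨W₀, hW₀, ⟨ψ₀⟩⟩ := H.locallyGa (f (U.ι x))
    obtain ⟨W, hW, hxW, hWW₀⟩ := exists_isAffineOpen_mem_and_subset (x := f (U.ι x)) hW₀
    let ψ := ψ₀.restrict (S.homOfLE hWW₀) W.ι (S.homOfLE_ι hWW₀)
    exact ⟨f ⁻¹ᵁ W, hxW, ψ.pullback f (f ∣_ W) (f ⁻¹ᵁ W).ι (morphismRestrict_ι f W),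
      (H.expansion W hW ψ a ha).pullback f (f ∣_ W) (f ⁻¹ᵁ W).ι (morphismRestrict_ι f W)⟩

end

/-! ## Drinfeld modules and their moduli functor -/

/-- A Drinfeld-`A`-module of rank `r` over `S`, where `A` is the ring of functions on the curve
that are regular outside `∞`, together with its characteristic `char : S → Spec A`. -/
structure DrinfeldModule {k : Type u} [Field k] [Finite k] (C : PointedCurve k) (r : ℕ)
    (S : Scheme.{u}) where
  char : S ⟶ Spec C.coordRing
  toModuleScheme : ModuleScheme C.coordRing S
  isDrinfeld : IsDrinfeld C.constants (C.tauDegree r) char toModuleScheme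

variable {k : Type u} [Field k] [Finite k]

namespace DrinfeldModule

variable {C : PointedCurve k} {r : ℕ} {S S' : Scheme.{u}}

/-- The pullback of a Drinfeld module along `f : S' → S`. -/
def pullback (M : DrinfeldModule C r S) (f : S' ⟶ S) : DrinfeldModule C r S' where
  char := f ≫ M.char
  toModuleScheme := M.toModuleScheme.pullback f
  isDrinfeld := M.isDrinfeld.pullback f

/-- Drinfeld modules of the same characteristic are equivalent if they are isomorphic. -/
instance setoid (C : PointedCurve k) (r : ℕ) (S : Scheme.{u}) :
    Setoid (DrinfeldModule C r S) where
  r M N := M.char = N.char ∧ M.toModuleScheme.Isomorphic N.toModuleScheme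
  iseqv :=
    { refl := fun _ => ⟨rfl, ⟨Iso.refl _⟩⟩
      symm := fun ⟨h, ⟨e⟩⟩ => ⟨h.symm, ⟨e.symm⟩⟩
      trans := fun ⟨h, ⟨e⟩⟩ ⟨h', ⟨e'⟩⟩ => ⟨h.trans h', ⟨e ≪≫ e'⟩⟩ }

end DrinfeldModule

/-- The moduli functor of Drinfeld-`A`-modules of rank `r`, on all schemes `S`: an element over `S`
is a morphism `c : S → Spec A` together with an isomorphism class of Drinfeld-`A`-modules of rank
`r` and characteristic `c` over `S`. -/
def moduli (C : PointedCurve k) (r : ℕ) : Scheme.{u}ᵒᵖ ⥤ Type (u + 1) where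
  obj S := Quotient (DrinfeldModule.setoid C r S.unop)
  map f := TypeCat.ofHom (Quotient.map (fun M => M.pullback f.unop) fun M N ⟨h, ⟨e⟩⟩ =>
    ⟨congrArg (f.unop ≫ ·) h, ⟨Functor.isoWhiskerLeft (Over.map f.unop).op e⟩⟩)
  map_id S := by
    ext x
    induction x using Quotient.inductionOn with | _ M
    exact Quotient.sound ⟨Category.id_comp _,
      ⟨Functor.isoWhiskerRight (NatIso.op (Over.mapId S.unop).symm) M.toModuleScheme.points⟩⟩
  map_comp f g := by
    ext x
    induction x using Quotient.inductionOn with | _ M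
    exact Quotient.sound ⟨Category.assoc _ _ _,
      ⟨Functor.isoWhiskerRight (NatIso.op (Over.mapComp g.unop f.unop).symm)
        M.toModuleScheme.points⟩⟩

/-- `ρ` is the restriction of coefficients morphism: it maps the class of `(E', φ')` of
characteristic `c'` to the class of `(E', φ' ∘ π^*)`, of characteristic `Spec(π^*) ∘ c'`. In
particular the latter is a Drinfeld module of rank `n r'`. -/
def IsRestrictionOfCoefficients {C' C : PointedCurve k} (π : PointedCurve.Cover C' C) {r' r : ℕ}
    (ρ : moduli C' r' ⟶ moduli C r) : Prop :=
  ∀ (S : Scheme.{u}) (M' : DrinfeldModule C' r' S), ∃ M : DrinfeldModule C r S,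
    M.char = M'.char ≫ Spec.map π.coordMap ∧
    M.toModuleScheme = M'.toModuleScheme.restrictScalars π.coordMap ∧
    ρ.app (op S) (Quotient.mk _ M') = Quotient.mk _ M

/-- The valuative criterion for properness for a morphism `ρ : F → G` of functors on schemes: for
every valuation ring `R` with fraction field `K`, every commutative square of solid arrows
`Spec K → F`, `Spec R → G` over `ρ` has a unique diagonal `Spec R → F`. By the Yoneda lemma a
morphism from `Spec R` to `F` is an element of `F (Spec R)`. -/
def ValuativeCriterion {F G : Scheme.{u}ᵒᵖ ⥤ Type (u + 1)} (ρ : F ⟶ G) : Prop :=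
  ∀ (R K : Type u) [CommRing R] [IsDomain R] [ValuationRing R] [Field K] [Algebra R K]
    [IsFractionRing R K] (x : F.obj (op (Spec (.of K)))) (y : G.obj (op (Spec (.of R)))),
    ρ.app _ x = G.map (Spec.map (CommRingCat.ofHom (algebraMap R K))).op y →
    ∃! z : F.obj (op (Spec (.of R))),
      F.map (Spec.map (CommRingCat.ofHom (algebraMap R K))).op z = x ∧ ρ.app _ z = y

end DrinfeldRestriction

end

/-!
A Drinfeld module over the spectrum of a valuation ring `R` (or of a field) is globally isomorphic to
the additive group as a group scheme, because the closed point has only one open neighbourhood. It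
is therefore the same thing as a family of additive polynomials `P a ∈ R[X]`, for `a : A`, with
`P (a + b) = P a + P b` and `P (a * b) = P a ∘ P b`, of prescribed degrees and with invertible
leading coefficients; isomorphisms are multiplications by units `u` of `R` with `P' a ∘ u = u ∘ P a`
(`IsDrinfeld.exists_gaAction`, `GaAction.isDrinfeld`, `GaAction.isomorphic`, `GaAction.exists_unit`).

*Restriction of coefficients has rank `n r'`.* The local rings of the curves at `∞` and `∞'` are
discrete valuation rings, and the second is finite over the first since `∞'` is the only point above
`∞`. The identity `e f = n` gives `d'(π^* a) = d(a)` (`PointedCurve.Cover.tauDegree_coordMap`).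

*Existence in the valuative criterion.* In coordinates there are polynomials `P a ∈ R[X]`, for
`a : A`, and `Q b ∈ K[X]`, for `b : A'`, and after a change of the second coordinate by a unit of `K`
one has `Q (π^* a) = P a`. If some `a` has `deg P a ≥ 2`, then `Q b` commutes with `P a` under
composition, and a polynomial over `K` that commutes with an integral polynomial of degree at least
two with invertible leading coefficient is integral (`exists_map_eq_of_comp_comm`); comparing leading
coefficients shows that its own leading coefficient is invertible. If all `P a` are linear, so are
all `Q b`, since `A'` is integral over `A` (`PointedCurve.Cover.isIntegral_coordMap`), and their
slopes lie in `R` since `R` is integrally closed. Both cases are in `IsPolyAction.exists_lift`.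

*Uniqueness.* An isomorphism over `K` between two Drinfeld modules over `R` is multiplication by some
`u : Kˣ`. Comparing the leading coefficients of an element that acts by a polynomial of degree
`D ≥ 2` shows that `u ^ (D - 1)` is a unit of `R`, hence so is `u`; if everything acts linearly the
two actions are equal (`IsPolyAction.exists_unit_intertwining`).
-/


noncomputable section

namespace DrinfeldRestriction

/-! ### Polynomial actions over valuation rings -/

section

open Polynomial

section
variable {R K : Type*} [CommRing R] [IsDomain R] [ValuationRing R] [Field K] [Algebra R K]
  [IsFractionRing R K]

/-- Over a valuation ring, a finite family of elements of the fraction field has a member which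
divides all the others: a nonzero polynomial is a scalar times a primitive polynomial. -/
theorem exists_eq_C_mul_map_of_ne_zero (f : K[X]) (hf : f ≠ 0) :
    ∃ (c : K) (f₀ : R[X]), c ≠ 0 ∧ f = C c * f₀.map (algebraMap R K) ∧ ∃ i, f₀.coeff i = 1 := by
  obtain ⟨i, hi, hmax⟩ := Finset.exists_max_image f.support
    (fun i => ValuationRing.valuation R K (f.coeff i)) (by simpa using hf)
  have hc : f.coeff i ≠ 0 := by simpa using hi
  have hle : ∀ j, ValuationRing.valuation R K (f.coeff j) ≤ ValuationRing.valuation R K (f.coeff i) :=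
    fun j => by
      by_cases hj : f.coeff j = 0
      · simp [hj]
      · exact hmax j (by simpa using hj)
  have hint : ∀ j, ∃ r : R, algebraMap R K r = (f.coeff i)⁻¹ * f.coeff j := fun j => by
    rw [← ValuationRing.mem_integer_iff, Valuation.mem_integer_iff, map_mul, map_inv₀]
    rw [inv_mul_le_one₀ (by simpa [zero_lt_iff] using hc)]
    exact hle j
  have hl : C (f.coeff i)⁻¹ * f ∈ lifts (algebraMap R K) := by
    rw [lifts_iff_coeff_lifts]
    intro j
    obtain ⟨r, hr⟩ := hint j
    exact ⟨r, by rw [coeff_C_mul, hr]⟩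
  obtain ⟨f₀, h₀⟩ := (mem_lifts _).mp hl
  refine ⟨f.coeff i, f₀, hc, ?_, i, ?_⟩
  · rw [h₀, ← mul_assoc, ← C_mul, mul_inv_cancel₀ hc, C_1, one_mul]
  · apply IsFractionRing.injective R K
    rw [← coeff_map, h₀, coeff_C_mul, inv_mul_cancel₀ hc, map_one]

/-- A polynomial over the fraction field of a valuation ring that commutes, under composition, with
an integral polynomial of degree at least two with invertible leading coefficient is integral. If
`f = c • f₀` with `f₀` primitive and `c` not integral, divide `g (c • f₀) = c • f₀ (g)` by
`c ^ deg g`: modulo the maximal ideal this is `lc(g) * f₀ ^ deg g = 0`. -/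
theorem exists_map_eq_of_comp_comm {f : K[X]} {g : R[X]} (hg : IsUnit g.leadingCoeff)
    (hg2 : 2 ≤ g.natDegree)
    (h : f.comp (g.map (algebraMap R K)) = (g.map (algebraMap R K)).comp f) :
    ∃ f₀ : R[X], f₀.map (algebraMap R K) = f := by
  by_cases hf : f = 0
  · exact ⟨0, by simp [hf]⟩
  obtain ⟨c, f₀, hc, rfl, i, hi⟩ := exists_eq_C_mul_map_of_ne_zero (R := R) f hf
  rcases ValuationRing.isInteger_or_isInteger R c with ⟨r, rfl⟩ | ⟨s, hs⟩
  · exact ⟨C r * f₀, by simp⟩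
  by_cases hsu : IsUnit s
  · obtain ⟨s, rfl⟩ := hsu
    refine ⟨C (↑s⁻¹ : R) * f₀, ?_⟩
    have : algebraMap R K ↑s⁻¹ = c := by
      have h1 : algebraMap R K ↑s⁻¹ * algebraMap R K s = 1 := by rw [← map_mul]; simp
      rw [hs] at h1
      field_simp at h1
      exact h1
    simp [this]
  exfalso
  set D := g.natDegree with hD
  have hinj : Function.Injective (Polynomial.map (algebraMap R K)) :=
    map_injective _ (IsFractionRing.injective R K)
  -- the equation multiplied by `s ^ D`, where `s = c⁻¹`
  have key : C (s ^ (D - 1)) * f₀.comp g =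
      ∑ j ∈ Finset.range (D + 1), C (g.coeff j * s ^ (D - j)) * f₀ ^ j := by
    apply hinj
    have hcs : c * algebraMap R K s = 1 := by rw [hs]; exact mul_inv_cancel₀ hc
    have h2 := congr(C (algebraMap R K s ^ D) * $h)
    rw [mul_comp, C_comp, ← Polynomial.map_comp, ← mul_assoc, ← C_mul] at h2
    have h3 : algebraMap R K s ^ D * c = algebraMap R K (s ^ (D - 1)) := by
      obtain ⟨D', hD'⟩ : ∃ D', D = D' + 1 := ⟨D - 1, by omega⟩
      rw [hD', pow_succ, mul_assoc, mul_comm _ c, hcs]; simp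
    rw [h3] at h2
    rw [Polynomial.map_mul, map_C, h2, comp, eval₂_map, eval₂_eq_sum_range, ← hD, Finset.mul_sum,
      Polynomial.map_sum]
    refine Finset.sum_congr rfl fun j hj => ?_
    have hj' : j ≤ D := by simpa [Nat.lt_succ_iff] using hj
    have h4 : algebraMap R K s ^ D * c ^ j = algebraMap R K s ^ (D - j) := by
      rw [← Nat.sub_add_cancel hj', pow_add, mul_assoc, ← mul_pow, mul_comm _ c, hcs]; simp
    have h5 := congr((C $h4 : K[X]))
    simp only [map_mul, map_pow] at h5
    simp only [RingHom.comp_apply, Polynomial.map_mul, map_C, Polynomial.map_pow, map_mul, map_pow,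
      mul_pow, ← h5]
    ring
  have hs0 : IsLocalRing.residue R s = 0 := by
    rwa [IsLocalRing.residue_eq_zero_iff, IsLocalRing.mem_maximalIdeal]
  have k2 := congr(($key).map (IsLocalRing.residue R))
  rw [Polynomial.map_mul, map_C, map_pow, hs0, zero_pow (by omega), C_0, zero_mul,
    Polynomial.map_sum, Finset.sum_range_succ, Finset.sum_eq_zero, zero_add] at k2
  · rw [Nat.sub_self, pow_zero, mul_one, Polynomial.map_mul, map_C, Polynomial.map_pow, eq_comm,
      mul_eq_zero, C_eq_zero] at k2
    rcases k2 with k2 | k2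
    · exact (hg.map (IsLocalRing.residue R)).ne_zero k2
    · have := congr(($(pow_eq_zero_iff (by omega : D ≠ 0) |>.mp k2)).coeff i)
      rw [coeff_map, hi] at this
      simp at this
  · intro j hj
    have : D - j ≠ 0 := by simp at hj; omega
    simp [hs0, this]

end

/-- Compare the leading coefficients of `f ∘ g` and `g ∘ f`. -/
theorem isUnit_leadingCoeff_of_comp_comm {R : Type*} [CommRing R] [IsDomain R]
    {f g : R[X]} (hg : IsUnit g.leadingCoeff)
    (hg2 : 2 ≤ g.natDegree) (hf : f.natDegree ≠ 0) (h : f.comp g = g.comp f) :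
    IsUnit f.leadingCoeff := by
  have h1 := congr(leadingCoeff $h)
  rw [leadingCoeff_comp (by omega), leadingCoeff_comp hf] at h1
  obtain ⟨D, hD⟩ : ∃ D, g.natDegree = D + 2 := ⟨g.natDegree - 2, by omega⟩
  have hf0 : f.leadingCoeff ≠ 0 := by rw [Ne, leadingCoeff_eq_zero]; rintro rfl; simp at hf
  obtain ⟨E, hE⟩ : ∃ E, f.natDegree = E + 1 := ⟨f.natDegree - 1, by omega⟩
  have h2 : g.leadingCoeff ^ E = f.leadingCoeff ^ (D + 1) := by
    have h3 : (f.leadingCoeff * g.leadingCoeff) * g.leadingCoeff ^ E =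
        (f.leadingCoeff * g.leadingCoeff) * f.leadingCoeff ^ (D + 1) := by
      rw [hD, hE] at h1
      linear_combination h1
    exact mul_left_cancel₀ (mul_ne_zero hf0 hg.ne_zero) h3
  have h4 : IsUnit (f.leadingCoeff ^ (D + 1)) := h2 ▸ hg.pow E
  exact (isUnit_pow_iff (by omega)).mp h4

theorem eq_C_mul_X_of_natDegree_le_one {R : Type*} [CommRing R] {f : R[X]} (h : f.natDegree ≤ 1)
    (h0 : f.coeff 0 = 0) : f = C (f.coeff 1) * X := by
  conv_lhs => rw [eq_X_add_C_of_natDegree_le_one h, h0]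
  simp

/-- The data that a Drinfeld module over a ring `R` amounts to in a coordinate: each `a : A` acts on
the additive group by a polynomial without constant term, and this is compatible with the ring
structure of `A`, whose product corresponds to composition. -/
structure IsPolyAction {A R : Type*} [CommRing A] [CommRing R] (P : A → R[X]) : Prop where
  add (a b : A) : P (a + b) = P a + P b
  mul (a b : A) : P (a * b) = (P a).comp (P b)
  one : P 1 = X
  coeff_zero (a : A) : (P a).coeff 0 = 0

namespace IsPolyAction

section
variable {A R : Type*} [CommRing A] [CommRing R] {P : A → R[X]} (hP : IsPolyAction P)
include hP

theorem zero : P 0 = 0 := by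
  have := hP.add 0 0
  simpa using this

theorem sum {ι : Type*} (s : Finset ι) (f : ι → A) : P (∑ i ∈ s, f i) = ∑ i ∈ s, P (f i) := by
  classical
  induction s using Finset.induction_on with
  | empty => simp [hP.zero]
  | insert i s hi ih => rw [Finset.sum_insert hi, Finset.sum_insert hi, hP.add, ih]

/-- The action on the tangent space. -/
def slope : A →+* R where
  toFun a := (P a).coeff 1
  map_one' := by simp [hP.one]
  map_zero' := by simp [hP.zero]
  map_add' a b := by simp [hP.add]
  map_mul' a b := by
    have hF : ∀ G : R[X], (derivative G).eval 0 = G.coeff 1 := fun G => by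
      rw [← coeff_zero_eq_eval_zero, coeff_derivative]; simp
    rw [hP.mul, ← hF, ← hF, ← hF, derivative_comp, eval_mul, eval_comp,
      ← coeff_zero_eq_eval_zero (P b), hP.coeff_zero, mul_comm]

theorem slope_apply (a : A) : hP.slope a = (P a).coeff 1 := rfl

theorem comp_comm (a b : A) : (P a).comp (P b) = (P b).comp (P a) := by
  rw [← hP.mul, mul_comm, hP.mul]

theorem natDegree_pow [IsDomain R] (a : A) (n : ℕ) :
    (P (a ^ n)).natDegree = (P a).natDegree ^ n := by
  induction n with
  | zero => simp [hP.one]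
  | succ n ih => rw [pow_succ, hP.mul, natDegree_comp, ih, pow_succ]

/-- Conjugation by a homothety. -/
theorem conj (u : Rˣ) :
    IsPolyAction fun a => C (u : R) * (P a).comp (C ((u⁻¹ : Rˣ) : R) * X) where
  add a b := by simp [hP.add, mul_add]
  mul a b := by
    simp only [hP.mul, mul_comp, C_comp, comp_assoc, X_comp]
    congr 3
    rw [← mul_assoc, ← C_mul]
    simp
  one := by simp [hP.one, ← mul_assoc, ← C_mul]
  coeff_zero a := by
    rw [coeff_C_mul, coeff_zero_eq_eval_zero, eval_comp, eval_C_mul, eval_X, mul_zero,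
      ← coeff_zero_eq_eval_zero, hP.coeff_zero, mul_zero]

end

/-- If all elements of `A` act linearly, so do the elements which are integral over `A`: the degree
of the `i`-th power of `b` grows exponentially with `i` otherwise. -/
theorem natDegree_le_one_of_isIntegral {A A' K : Type*} [CommRing A] [CommRing A'] [Algebra A A']
    [Field K] {Q : A' → K[X]} (hQ : IsPolyAction Q)
    (hlin : ∀ a : A, (Q (algebraMap A A' a)).natDegree ≤ 1) {b : A'} (hb : IsIntegral A b) :
    (Q b).natDegree ≤ 1 := by
  obtain ⟨p, hp, hpb⟩ := hb
  by_contra! hD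
  set D := (Q b).natDegree
  rcases Nat.eq_zero_or_pos p.natDegree with h0 | h0
  · rw [hp.natDegree_eq_zero.mp h0] at hpb
    have h1 : (1 : A') = 0 := by simpa using hpb
    have := congr((Q $h1).natDegree)
    have hsub : b = 0 := by rw [← mul_one b, h1, mul_zero]
    have h2 : D = 0 := by simp only [D]; rw [hsub, hQ.zero, natDegree_zero]
    omega
  rw [eval₂_eq_sum_range, Finset.sum_range_succ] at hpb
  have h1 := congr(Q $hpb)
  rw [hQ.add, hQ.sum, hQ.zero, hp.coeff_natDegree, map_one, one_mul] at h1
  have h2 : (∑ i ∈ Finset.range p.natDegree,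
      Q (algebraMap A A' (p.coeff i) * b ^ i)).natDegree ≤ D ^ (p.natDegree - 1) := by
    refine natDegree_sum_le_of_forall_le _ _ fun i hi => ?_
    rw [hQ.mul, natDegree_comp, hQ.natDegree_pow]
    have : i ≤ p.natDegree - 1 := by simp at hi; omega
    calc _ ≤ 1 * D ^ i := Nat.mul_le_mul_right _ (hlin _)
      _ ≤ _ := by rw [one_mul]; exact Nat.pow_le_pow_right (by omega) this
  rw [eq_neg_of_add_eq_zero_left h1, natDegree_neg, hQ.natDegree_pow] at h2
  have := (Nat.pow_le_pow_iff_right (a := D) (by omega)).mp h2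
  omega

section
variable {A' R K : Type*} [CommRing A']
  [CommRing R] [IsDomain R] [ValuationRing R] [Field K] [Algebra R K] [IsFractionRing R K]

/-- Properness at the level of coordinates: an action of `A'` over the field `K` whose restriction to
`A` is integral, with invertible leading coefficients, is itself integral with invertible leading
coefficients. If some element of `A` acts by a polynomial of degree at least two, this holds for
every polynomial that commutes with the latter. Otherwise everything acts linearly, through a ring
homomorphism `A' → K`, and `R` is integrally closed. -/
theorem exists_lift {A : Type*} [CommRing A] [Algebra A A'] [IsDomain A']
    [Algebra.IsIntegral A A'] {P : A → R[X]} {Q : A' → K[X]} (hQ : IsPolyAction Q)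
    (hPQ : ∀ a, Q (algebraMap A A' a) = (P a).map (algebraMap R K))
    (hP : ∀ a ≠ 0, IsUnit (P a).leadingCoeff) (hQ0 : ∀ b ≠ 0, (Q b).natDegree ≠ 0)
    {b : A'} (hb : b ≠ 0) :
    ∃ f : R[X], f.map (algebraMap R K) = Q b ∧ IsUnit f.leadingCoeff := by
  have hinj := IsFractionRing.injective R K
  by_cases hdeg : ∃ a ≠ 0, 2 ≤ (P a).natDegree
  · obtain ⟨a, ha, ha2⟩ := hdeg
    have hcomm := hQ.comp_comm b (algebraMap A A' a)
    rw [hPQ] at hcomm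
    obtain ⟨f, hf⟩ := exists_map_eq_of_comp_comm (hP a ha) ha2 hcomm
    refine ⟨f, hf, isUnit_leadingCoeff_of_comp_comm (hP a ha) ha2 ?_ ?_⟩
    · rw [← natDegree_map_eq_of_injective hinj, hf]; exact hQ0 b hb
    · apply map_injective _ hinj
      rw [Polynomial.map_comp, Polynomial.map_comp, hf, hcomm]
  · push Not at hdeg
    have hlin : ∀ a : A, (Q (algebraMap A A' a)).natDegree ≤ 1 := fun a => by
      rw [hPQ, natDegree_map_eq_of_injective hinj]
      by_cases ha : a = 0
      · have h0 := hPQ 0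
        rw [map_zero, hQ.zero, eq_comm, Polynomial.map_eq_zero_iff hinj] at h0
        rw [ha, h0, natDegree_zero]; omega
      · have := hdeg a ha; omega
    have hlin' : ∀ b : A', ∃ r : R, Q b = C (algebraMap R K r) * X := fun b => by
      have h1 := hQ.natDegree_le_one_of_isIntegral hlin (Algebra.IsIntegral.isIntegral (R := A) b)
      have h2 := eq_C_mul_X_of_natDegree_le_one h1 (hQ.coeff_zero b)
      obtain ⟨p, hp, hpb⟩ := Algebra.IsIntegral.isIntegral (R := A) b
      -- the slope of `Q b` is integral over `R`
      have h3 : IsIntegral R ((Q b).coeff 1) := by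
        let θ : A →+* K := hQ.slope.comp (algebraMap A A')
        have hθ : ∀ a, θ a ∈ (algebraMap R K).range := fun a => by
          refine ⟨(P a).coeff 1, ?_⟩
          change _ = (Q (algebraMap A A' a)).coeff 1
          rw [hPQ, coeff_map]
        have hl : p.map θ ∈ lifts (algebraMap R K) := by
          rw [lifts_iff_coeff_lifts]
          intro i
          rw [coeff_map]
          exact hθ _
        obtain ⟨p', hp', -, hm⟩ := lifts_and_natDegree_eq_and_monic hl (hp.map θ)
        refine ⟨p', hm, ?_⟩
        rw [← Polynomial.eval_map, hp', Polynomial.eval_map]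
        have := congr(hQ.slope $hpb)
        rw [hom_eval₂, map_zero] at this
        exact this
      obtain ⟨r, hr⟩ := IsIntegrallyClosed.isIntegral_iff.mp h3
      exact ⟨r, by rw [hr, ← h2]⟩
    obtain ⟨r, hr⟩ := hlin' b
    refine ⟨C r * X, by simp [hr], ?_⟩
    have := (algebraMap A A').domain_nontrivial
    obtain ⟨a, ha, ha0⟩ : ∃ a ∈ (Ideal.span {b}).comap (algebraMap A A'), a ≠ 0 := by
      refine (Submodule.ne_bot_iff _).mp (Ideal.comap_ne_bot_of_integral_mem hb
        (Ideal.mem_span_singleton_self b) (Algebra.IsIntegral.isIntegral (R := A) b))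
    obtain ⟨b', hb'⟩ := Ideal.mem_span_singleton'.mp (Ideal.mem_comap.mp ha)
    obtain ⟨r', hr'⟩ := hlin' b'
    have h4 : P a = C (r' * r) * X := by
      apply map_injective _ hinj
      rw [← hPQ, ← hb', hQ.mul, hr, hr']
      simp [mul_assoc]
    have h5 := hP a ha0
    have hrr : r' * r ≠ 0 := fun h => by rw [h4, h] at h5; simp at h5
    rw [h4, leadingCoeff_C_mul_X] at h5
    have hr0 : r ≠ 0 := right_ne_zero_of_mul hrr
    rw [leadingCoeff_C_mul_X]
    exact isUnit_of_mul_isUnit_right h5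

/-- Separatedness at the level of coordinates: two integral actions with invertible leading
coefficients which are isomorphic over `K` are isomorphic over `R`. If some element acts by a
polynomial of degree at least two, the isomorphism over `K` itself is integral; if everything acts
linearly, the two actions are equal. -/
theorem exists_unit_intertwining {P P' : A' → R[X]} (hP : IsPolyAction P)
    (hP' : IsPolyAction P') (hu : ∀ b ≠ 0, IsUnit (P b).leadingCoeff)
    (hu' : ∀ b ≠ 0, IsUnit (P' b).leadingCoeff) {c : K} (hc : c ≠ 0)
    (h : ∀ b, ((P' b).map (algebraMap R K)).comp (C c * X) = C c * (P b).map (algebraMap R K)) :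
    ∃ v : Rˣ, ∀ b, (P' b).comp (C (v : R) * X) = C (v : R) * P b := by
  have hinj := IsFractionRing.injective R K
  have hcoeff : ∀ b i, algebraMap R K ((P' b).coeff i) * c ^ i =
      c * algebraMap R K ((P b).coeff i) := fun b i => by
    have := congr(($(h b)).coeff i)
    rwa [comp_C_mul_X_coeff, coeff_C_mul, coeff_map, coeff_map] at this
  have hdegs : ∀ b, (P' b).natDegree = (P b).natDegree := fun b => by
    have := congr(natDegree $(h b))
    rwa [natDegree_comp, natDegree_C_mul_X _ hc, mul_one, natDegree_C_mul hc,
      natDegree_map_eq_of_injective hinj, natDegree_map_eq_of_injective hinj] at this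
  by_cases hdeg : ∃ b ≠ 0, 2 ≤ (P b).natDegree
  · obtain ⟨b, hb, hb2⟩ := hdeg
    obtain ⟨D, hD⟩ : ∃ D, (P b).natDegree = D + 2 := ⟨(P b).natDegree - 2, by omega⟩
    obtain ⟨l, hl⟩ := hu b hb
    obtain ⟨l', hl'⟩ := hu' b hb
    have h1 := hcoeff b (D + 2)
    have e1 : (P' b).coeff (D + 2) = l' := by rw [hl', leadingCoeff, hdegs, hD]
    have e2 : (P b).coeff (D + 2) = l := by rw [hl, leadingCoeff, hD]
    rw [e1, e2] at h1
    -- `c ^ (D + 1)` is a unit of `R`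
    have hpow : c ^ (D + 1) = algebraMap R K (↑(l * l'⁻¹) : R) := by
      have h2 : algebraMap R K l' * algebraMap R K ↑l'⁻¹ = 1 := by rw [← map_mul]; simp
      rw [Units.val_mul, map_mul]
      apply mul_left_cancel₀ hc
      linear_combination algebraMap R K ↑l'⁻¹ * h1 - c ^ (D + 2) * h2
    obtain ⟨v, hv⟩ : ∃ v : R, algebraMap R K v = c := by
      refine IsIntegrallyClosed.isIntegral_iff.mp (IsIntegral.of_pow (n := D + 1) (by omega) ?_)
      rw [hpow]; exact isIntegral_algebraMap
    have hvu : IsUnit v := by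
      rw [← isUnit_pow_iff (n := D + 1) (by omega)]
      have : v ^ (D + 1) = ↑(l * l'⁻¹) := hinj (by rw [map_pow, hv, hpow])
      rw [this]; exact Units.isUnit _
    obtain ⟨v, rfl⟩ := hvu
    refine ⟨v, fun b => map_injective _ hinj ?_⟩
    rw [Polynomial.map_comp, Polynomial.map_mul, Polynomial.map_mul, map_C, map_X, hv, h]
  · push Not at hdeg
    have hdeg' : ∀ b, (P b).natDegree ≤ 1 := fun b => by
      by_cases hb : b = 0
      · simp [hb, hP.zero]
      · have := hdeg b hb; omega
    refine ⟨1, fun b => ?_⟩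
    have e1 := eq_C_mul_X_of_natDegree_le_one (hdeg' b) (hP.coeff_zero b)
    have e2 := eq_C_mul_X_of_natDegree_le_one ((hdegs b).trans_le (hdeg' b)) (hP'.coeff_zero b)
    have : (P' b).coeff 1 = (P b).coeff 1 := hinj (mul_right_cancel₀ hc (by
      have := hcoeff b 1
      rw [pow_one] at this
      rw [this, mul_comm]))
    rw [Units.val_one, C_1, one_mul, one_mul, comp_X, e1, e2, this]

end

end IsPolyAction

end

/-! ### The local rings of a curve -/

section

/-- The local rings of a smooth algebra of relative dimension one over a field have principal
maximal ideals, since the algebra is étale over a polynomial ring in one variable. -/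
theorem isPrincipal_maximalIdeal_of_isStandardSmooth {F B : Type u} [Field F] [CommRing B]
    [Algebra F B] [Algebra.IsStandardSmoothOfRelativeDimension 1 F B] (q : Ideal B) [q.IsPrime] :
    (IsLocalRing.maximalIdeal (Localization.AtPrime q)).IsPrincipal := by
  obtain ⟨g, hg⟩ := Algebra.IsStandardSmoothOfRelativeDimension.exists_etale_mvPolynomial 1 F B
  have : IsPrincipalIdealRing (MvPolynomial (Fin 1) F) :=
    IsPrincipalIdealRing.of_surjective (MvPolynomial.uniqueAlgEquiv F (Fin 1)).symm
      (MvPolynomial.uniqueAlgEquiv F (Fin 1)).symm.surjective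
  let _ : Algebra (MvPolynomial (Fin 1) F) B := g.toRingHom.toAlgebra
  have : Algebra.Etale (MvPolynomial (Fin 1) F) B := hg
  let p := q.under (MvPolynomial (Fin 1) F)
  let _ := Localization.AtPrime.algebraOfLiesOver p q
  have h := (Algebra.isUnramifiedAt_iff_map_eq (MvPolynomial (Fin 1) F) p q).mp inferInstance
  rw [← h.2]
  infer_instance

namespace PointedCurve

variable {k : Type u} [Field k] (C : PointedCurve k)

theorem isPrincipal_maximalIdeal_stalk (x : C.X) :
    (IsLocalRing.maximalIdeal (C.X.presheaf.stalk x)).IsPrincipal := by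
  obtain ⟨U, hU, V, hV, hx, e, hst⟩ :=
    SmoothOfRelativeDimension.exists_isStandardSmoothOfRelativeDimension (f := C.str) (n := 1) x
  have hUt : U = ⊤ := by
    ext y
    have : y = C.str x := Subsingleton.elim _ _
    simpa [this] using e hx
  subst hUt
  have f2 : IsField Γ(Spec (.of k), ⊤) := isField_of_isIntegral_of_subsingleton _
  let _ := f2.toField
  algebraize [(C.str.appLE ⊤ V e).hom]
  have := hV.isLocalization_stalk ⟨x, hx⟩
  let 𝔮 := (hV.primeIdealOf ⟨x, hx⟩).asIdeal
  have h := isPrincipal_maximalIdeal_of_isStandardSmooth (F := Γ(Spec (.of k), ⊤)) 𝔮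
  let _ : Algebra Γ(C.X, V) (C.X.presheaf.stalk x) := C.X.presheaf.algebra_section_stalk ⟨x, hx⟩
  have : IsLocalization 𝔮.primeCompl (C.X.presheaf.stalk x) := this
  let ε := IsLocalization.algEquiv 𝔮.primeCompl (Localization.AtPrime 𝔮) (C.X.presheaf.stalk x)
  have h2 : (IsLocalRing.maximalIdeal (Localization.AtPrime 𝔮)).map ε.toRingEquiv =
      IsLocalRing.maximalIdeal (C.X.presheaf.stalk x) :=
    IsLocalRing.map_ringEquiv_maximalIdeal ε.toRingEquiv
  obtain ⟨a, ha⟩ := h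
  rw [← h2, ha]
  exact ⟨ε a, Ideal.map_span _ _ |>.trans (by rw [Set.image_singleton]; rfl)⟩

instance (x : C.X) : IsPrincipalIdealRing (C.X.presheaf.stalk x) :=
  ((tfae_of_isNoetherianRing_of_isLocalRing_of_isDomain _).out 4 0).mp
    (C.isPrincipal_maximalIdeal_stalk x)

theorem coheight_pt [Finite k] : Order.coheight C.pt = 1 := by
  apply le_antisymm
  · have : Ring.KrullDimLE 1 (C.X.presheaf.stalk C.pt) := inferInstance
    rw [Ring.krullDimLE_iff, ringKrullDim_stalk_eq_coheight] at this
    exact_mod_cast this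
  · rw [Order.one_le_iff_ne_zero, Ne, Order.coheight_eq_zero]
    intro h
    have h1 : C.pt ≤ genericPoint C.X := (genericPoint_spec C.X).specializes trivial
    exact C.genericPoint_ne (Specializes.antisymm h1 (h h1)).eq

instance [Finite k] : IsDiscreteValuationRing (C.X.presheaf.stalk C.pt) := by
  have h : ¬ IsField (C.X.presheaf.stalk C.pt) := fun h => by
    have h1 := ringKrullDim_stalk_eq_coheight C.pt
    rw [C.coheight_pt, ringKrullDim_eq_zero_of_isField h] at h1
    exact absurd h1 (by decide)
  exact ((IsDiscreteValuationRing.TFAE _ h).out 4 0).mp (C.isPrincipal_maximalIdeal_stalk C.pt)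

/-- A rational function which is regular at each point of `U` is regular on `U`. -/
theorem exists_germToFunctionField_eq (U : C.X.Opens) [Nonempty U] (f : C.X.functionField)
    (h : ∀ x ∈ U, f ∈ (algebraMap (C.X.presheaf.stalk x) C.X.functionField).range) :
    ∃ a : Γ(C.X, U), C.X.germToFunctionField U a = f := by
  have h1 : ∀ x : U, ∃ (V : C.X.Opens) (_ : V ≤ U) (hx : x.1 ∈ V) (s : Γ(C.X, V)),
      C.X.presheaf.germ V (genericPoint C.X) (((genericPoint_spec C.X).mem_open_set_iff
        V.isOpen).mpr ⟨x, trivial, hx⟩) s = f := fun x => by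
    obtain ⟨g, hg⟩ := h x x.2
    obtain ⟨V, hxV, s, rfl⟩ := C.X.presheaf.exists_germ_eq g
    refine ⟨V ⊓ U, inf_le_right, ⟨hxV, x.2⟩, C.X.presheaf.map (homOfLE inf_le_left).op s, ?_⟩
    have : Nonempty V := ⟨⟨x, hxV⟩⟩
    rw [← hg, Scheme.algebraMap_germ_eq_germToFunctionField]
    exact TopCat.Presheaf.germ_res_apply _ _ _ _ _
  choose V hVU hxV s hs using h1
  obtain ⟨a, ha, -⟩ := TopCat.Sheaf.existsUnique_gluing' C.X.sheaf V U (fun x => homOfLE (hVU x))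
    (fun x hx => by simpa using ⟨x, hx, hxV ⟨x, hx⟩⟩) s (fun x y => by
      have hη : ∀ x, genericPoint C.X ∈ V x := fun x =>
        ((genericPoint_spec C.X).mem_open_set_iff (V x).isOpen).mpr ⟨x, trivial, hxV x⟩
      apply germ_injective_of_isIntegral (X := C.X) (U := V x ⊓ V y) (genericPoint C.X) ⟨hη x, hη y⟩
      erw [TopCat.Presheaf.germ_res_apply, TopCat.Presheaf.germ_res_apply]
      rw [hs, hs])
  refine ⟨a, ?_⟩
  obtain ⟨x⟩ := ‹Nonempty U›
  rw [← hs x, ← ha x]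
  exact (TopCat.Presheaf.germ_res_apply _ _ _ _ _).symm

end PointedCurve

end

/-! ### Orders in extensions of discrete valuation rings -/

section

section
open IsLocalRing

variable {O O' : Type*} [CommRing O] [IsDomain O] [IsDiscreteValuationRing O] [CommRing O']
  [IsDomain O'] [IsDiscreteValuationRing O'] [Algebra O O']

/-- The fundamental identity `e f = n` for a finite extension of discrete valuation rings, where `e`
is given by the decomposition of a uniformizer and `n` is the degree of the fraction fields. -/
theorem mul_finrank_residueField_eq_finrank [Module.Finite O O'] [FaithfulSMul O O']
    [IsLocalHom (algebraMap O O')]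
    (F F' : Type*) [Field F] [Field F'] [Algebra O F] [IsFractionRing O F] [Algebra O' F']
    [IsFractionRing O' F'] [Algebra F F'] [Algebra O F'] [IsScalarTower O O' F']
    [IsScalarTower O F F'] {ϖ : O} {ϖ' : O'} (hϖ : Irreducible ϖ) (hϖ' : Irreducible ϖ') {e : ℕ}
    (he : Associated (algebraMap O O' ϖ) (ϖ' ^ e)) :
    e * Module.finrank (ResidueField O) (ResidueField O') = Module.finrank F F' := by
  have hq : (maximalIdeal O).primesOver O' = {maximalIdeal O'} := by
    ext Q
    simp only [Set.mem_singleton_iff]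
    constructor
    · rintro ⟨_, h⟩
      have := Ideal.isMaximal_of_isIntegral_of_isMaximal_comap (R := O) Q (by
        rw [← Ideal.under_def, ← h.over]; infer_instance)
      exact eq_maximalIdeal this
    · rintro rfl
      exact ⟨inferInstance, inferInstance⟩
  let _ : Fintype ((maximalIdeal O).primesOver O') := by rw [hq]; infer_instance
  have h1 := Ideal.sum_ramification_inertia_eq_finrank (S := O') (maximalIdeal O)
  have h0 : maximalIdeal O ≠ ⊥ := IsDiscreteValuationRing.not_a_field O
  have hu : ∀ q : (maximalIdeal O).primesOver O', q.1 = maximalIdeal O' := fun q => hq.le q.2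
  have : Subsingleton ((maximalIdeal O).primesOver O') :=
    ⟨fun a b => Subtype.ext ((hu a).trans (hu b).symm)⟩
  rw [Fintype.sum_subsingleton _ ⟨maximalIdeal O', hq.ge rfl⟩] at h1
  have hm : (maximalIdeal O).map (algebraMap O O') = maximalIdeal O' ^ e := by
    rw [hϖ.maximalIdeal_eq, hϖ'.maximalIdeal_eq, Ideal.map_span, Set.image_singleton,
      Ideal.span_singleton_pow, Ideal.span_singleton_eq_span_singleton]
    exact he
  have h2 : (maximalIdeal O').ramificationIdx O = e := by
    rw [← Ideal.ramificationIdx'_eq_ramificationIdx (maximalIdeal O) _ h0]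
    refine Ideal.ramificationIdx'_spec hm.le ?_
    rw [hm]
    intro h
    exact (Ideal.pow_right_strictAnti _ (IsDiscreteValuationRing.not_a_field O')
      (maximalIdeal.isMaximal O').ne_top (Nat.lt_succ_self e)).not_ge h
  have h3 : (maximalIdeal O').inertiaDeg O =
      Module.finrank (ResidueField O) (ResidueField O') := by
    rw [Ideal.inertiaDeg_eq_of_isMaximal (maximalIdeal O)]
    refine Algebra.finrank_eq_of_equiv_equiv (RingEquiv.refl (ResidueField O))
      (RingEquiv.refl (ResidueField O')) ?_
    refine Ideal.Quotient.ringHom_ext ?_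
    ext x
    rfl
  rw [h2, h3] at h1
  rw [h1, IsFractionRing.finrank_eq O F O' F']

/-- Normalized valuations in an extension of discrete valuation rings differ by the ramification
index. -/
theorem ordFrac_map_eq {F F' : Type*} [Field F] [Field F'] [Algebra O F] [IsFractionRing O F]
    [Algebra O' F'] [IsFractionRing O' F'] (φ : F →+* F')
    (hφ : ∀ x : O, φ (algebraMap O F x) = algebraMap O' F' (algebraMap O O' x))
    {ϖ : O} {ϖ' : O'} (hϖ : Irreducible ϖ) (hϖ' : Irreducible ϖ') {e : ℕ}
    (he : Associated (algebraMap O O' ϖ) (ϖ' ^ e)) (x : F) (hx : x ≠ 0) :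
    Ring.ordFrac O' (φ x) = Ring.ordFrac O x ^ e := by
  obtain ⟨n, v, rfl⟩ := IsDiscreteValuationRing.exists_units_eq_smul_zpow_of_irreducible hϖ hx
  obtain ⟨w, hw⟩ := he.symm
  rw [Units.smul_def, Algebra.smul_def, map_mul, map_zpow₀, hφ, hφ, ← hw]
  simp only [map_mul, map_zpow₀, map_pow]
  rw [Ring.ordFrac_irreducible hϖ', Ring.ordFrac_irreducible hϖ,
    Ring.ordFrac_of_isUnit (v.isUnit.map _), Ring.ordFrac_of_isUnit v.isUnit,
    Ring.ordFrac_of_isUnit w.isUnit, one_mul, one_mul, mul_one, ← zpow_natCast, ← zpow_natCast,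
    zpow_comm]

end

end

/-! ### Covers of curves and their function fields -/

section

/-- If `x` is the only point of its fibre under a finite morphism `f`, then the local ring at `x` is
finite over the local ring at `f x`. -/
theorem finite_stalkMap_of_isFinite {X Y : Scheme.{u}} (f : X ⟶ Y) [IsFinite f] (x : X)
    (hx : ∀ x', f x' = f x → x' = x) : (f.stalkMap x).hom.Finite := by
  obtain ⟨V, hV, hfx, -⟩ := exists_isAffineOpen_mem_and_subset (x := f x) (U := ⊤) trivial
  have hV' : IsAffineOpen (f ⁻¹ᵁ V) := hV.preimage f
  rw [RingHom.finite_respectsIso.arrow_mk_iso_iff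
    (IsAffineOpen.arrowStalkMapIso f V hV (f ⁻¹ᵁ V) hV' le_rfl hfx)]
  have hfin : (f.appLE V (f ⁻¹ᵁ V) le_rfl).hom.Finite := by
    rw [← Scheme.Hom.app_eq_appLE]
    exact f.finite_app V hV
  algebraize [(f.appLE V (f ⁻¹ᵁ V) le_rfl).hom]
  set q := (hV'.primeIdealOf ⟨x, hfx⟩).asIdeal with hq
  set p := (hV.primeIdealOf ⟨f x, hfx⟩).asIdeal with hp
  have hcomap : q.comap (f.appLE V (f ⁻¹ᵁ V) le_rfl).hom = p :=
    congr($(IsAffineOpen.comap_primeIdealOf_appLE V hV (f ⁻¹ᵁ V) hV' le_rfl hfx).1)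
  have : q.LiesOver p := ⟨hcomap.symm⟩
  let _ := Localization.AtPrime.algebraOfLiesOver p q
  have hpq : p.primesOver Γ(X, f ⁻¹ᵁ V) = {q} := by
    ext Q
    simp only [Set.mem_singleton_iff]
    constructor
    · rintro ⟨hQ, hQp⟩
      let y : Spec Γ(X, f ⁻¹ᵁ V) := (⟨Q, hQ⟩ : PrimeSpectrum _)
      let z : f ⁻¹ᵁ V := hV'.isoSpec.inv y
      have hz : hV'.primeIdealOf z = ⟨Q, hQ⟩ := by
        change hV'.isoSpec.hom (hV'.isoSpec.inv y) = y
        rw [← Scheme.Hom.comp_apply, Iso.inv_hom_id]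
        rfl
      have h1 := IsAffineOpen.comap_primeIdealOf_appLE (f := f) V hV (f ⁻¹ᵁ V) hV' le_rfl z.2
      have h2 : hV.primeIdealOf ⟨f z.1, z.2⟩ = hV.primeIdealOf ⟨f x, hfx⟩ := by
        rw [← h1]
        refine PrimeSpectrum.ext ?_
        rw [PrimeSpectrum.comap_asIdeal]
        change Ideal.comap _ (hV'.primeIdealOf z).asIdeal = _
        rw [hz]
        exact hQp.over.symm
      have h3 : f z.1 = f x := by
        have := congr(hV.fromSpec $h2)
        rwa [IsAffineOpen.fromSpec_primeIdealOf, IsAffineOpen.fromSpec_primeIdealOf] at this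
      have h4 : z = ⟨x, hfx⟩ := Subtype.ext (hx _ h3)
      rw [hq, ← h4, hz]
    · rintro rfl
      exact ⟨inferInstance, this⟩
  have h := Localization.finite_of_primesOver_eq_singleton hpq
  rw [← RingHom.finite_algebraMap, Localization.AtPrime.IsLiesOverAlgebra.algebraMap_eq] at h
  exact h

theorem residueDegree_comp {X Y Z : Scheme.{u}} (f : X ⟶ Y) (g : Y ⟶ Z) (x : X) :
    (f ≫ g).residueDegree x = g.residueDegree (f x) * f.residueDegree x := by
  let _ := (g.residueFieldMap (f x)).hom.toAlgebra
  let _ := (f.residueFieldMap x).hom.toAlgebra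
  let _ : Algebra (Z.residueField (g (f x))) (X.residueField x) :=
    ((f ≫ g).residueFieldMap x).hom.toAlgebra
  have : IsScalarTower (Z.residueField (g (f x))) (Y.residueField (f x)) (X.residueField x) :=
    IsScalarTower.of_algebraMap_eq' (by
      simp only [RingHom.algebraMap_toAlgebra]
      rw [← CommRingCat.hom_comp, ← Scheme.residueFieldMap_comp]
      rfl)
  exact (Module.finrank_mul_finrank (Z.residueField (g (f x))) (Y.residueField (f x))
    (X.residueField x)).symm

namespace PointedCurve.Cover

variable {k : Type u} [Field k] {C' C : PointedCurve k} (π : Cover C' C)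

instance : IsFinite π.hom := π.finite

theorem hom_pt : π.hom C'.pt = C.pt := (π.hom_eq_pt_iff _).mpr rfl

theorem stalkMap_germ (U : C.X.Opens) (V : C'.X.Opens) (e : V ≤ π.hom ⁻¹ᵁ U) {x : C'.X} (hx : x ∈ V)
    (hx' : π.hom x ∈ U) (a : Γ(C.X, U)) :
    π.hom.stalkMap x (C.X.presheaf.germ U (π.hom x) hx' a) =
      C'.X.presheaf.germ V x hx (π.hom.appLE U V e a) := by
  have h : C.X.presheaf.germ U (π.hom x) hx' ≫ π.hom.stalkMap x =
      π.hom.appLE U V e ≫ C'.X.presheaf.germ V x hx := by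
    rw [Scheme.Hom.germ_stalkMap, ← C'.X.presheaf.germ_res (homOfLE e) _ hx,
      Scheme.Hom.app_eq_appLE, Scheme.Hom.appLE_map_assoc]
  exact congr($h a)

variable [Finite k]

/-- The image of the generic point specializes to `∞`, is different from `∞`, and the local ring at
`∞` has only two primes. -/
theorem hom_genericPoint : π.hom (genericPoint C'.X) = genericPoint C.X := by
  have h1 : C.pt ≤ π.hom (genericPoint C'.X) := by
    rw [← π.hom_pt]
    exact ((genericPoint_spec C'.X).specializes trivial).map π.hom.continuous
  have h2 : ¬ π.hom (genericPoint C'.X) ≤ C.pt := fun h =>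
    C'.genericPoint_ne ((π.hom_eq_pt_iff _).mp (Specializes.antisymm h1 h).eq)
  have h3 := Order.coheight_strictAnti (lt_of_le_not_ge h1 h2) (by
    refine lt_of_le_of_lt (Order.coheight_anti h1) ?_
    rw [C.coheight_pt]; exact ENat.natCast_lt_top 1)
  rw [C.coheight_pt, Order.lt_one_iff, Order.coheight_eq_zero] at h3
  have h4 : π.hom (genericPoint C'.X) ≤ genericPoint C.X :=
    (genericPoint_spec C.X).specializes trivial
  exact (Specializes.antisymm (h3 h4) h4).eq

/-- The inclusion of function fields. -/
def functionFieldMap : C.X.functionField ⟶ C'.X.functionField :=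
  C.X.presheaf.stalkSpecializes (specializes_of_eq π.hom_genericPoint) ≫
    π.hom.stalkMap (genericPoint C'.X)

theorem functionFieldMap_algebraMap (x : C'.X) (a : C.X.presheaf.stalk (π.hom x)) :
    π.functionFieldMap (algebraMap _ C.X.functionField a) =
      algebraMap (C'.X.presheaf.stalk x) C'.X.functionField (π.hom.stalkMap x a) := by
  have h := Scheme.Hom.stalkSpecializes_stalkMap π.hom (genericPoint C'.X) x
    ((genericPoint_spec C'.X).specializes trivial)
  have h2 : C.X.presheaf.stalkSpecializes ((genericPoint_spec C.X).specializes trivial) ≫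
      π.functionFieldMap = π.hom.stalkMap x ≫
        C'.X.presheaf.stalkSpecializes ((genericPoint_spec C'.X).specializes trivial) := by
    rw [← h, functionFieldMap, TopCat.Presheaf.stalkSpecializes_comp_assoc]
  exact congr($h2 a)

theorem functionFieldMap_germ (U : C.X.Opens) [Nonempty U] (V : C'.X.Opens) [Nonempty V]
    (e : V ≤ π.hom ⁻¹ᵁ U) (a : Γ(C.X, U)) :
    π.functionFieldMap (C.X.germToFunctionField U a) =
      C'.X.germToFunctionField V (π.hom.appLE U V e a) := by
  obtain ⟨x, hx⟩ := ‹Nonempty V›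
  have hx' : π.hom x ∈ U := e hx
  rw [← Scheme.algebraMap_germ_eq_germToFunctionField C.X hx', functionFieldMap_algebraMap,
    ← Scheme.algebraMap_germ_eq_germToFunctionField C'.X hx, π.stalkMap_germ U V e hx hx']

theorem coordMap_injective : Function.Injective π.coordMap := by
  have h : Function.Injective (π.hom.appLE C.affinePart C'.affinePart π.affinePart_le) :=
    fun a b h => by
      apply Scheme.germToFunctionField_injective C.X C.affinePart
      apply π.functionFieldMap.hom.injective
      change π.functionFieldMap _ = π.functionFieldMap _
      rw [π.functionFieldMap_germ _ _ π.affinePart_le, π.functionFieldMap_germ _ _ π.affinePart_le,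
        h]
  exact h

theorem finrank_functionField :
    letI := π.functionFieldMap.hom.toAlgebra
    Module.finrank C.X.functionField C'.X.functionField = π.degree := by
  let _ := π.functionFieldMap.hom.toAlgebra
  let _ := (π.hom.residueFieldMap (genericPoint C'.X)).hom.toAlgebra
  have hs : ∀ (x : C.X) (h : x = genericPoint C.X),
      Function.Bijective (C.X.presheaf.stalkSpecializes (specializes_of_eq h) ≫ C.X.residue x) := by
    rintro x rfl
    rw [TopCat.Presheaf.stalkSpecializes_refl, Category.id_comp]
    exact ⟨RingHom.injective (C.X.residue (genericPoint C.X) : C.X.functionField ⟶ _).hom,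
      C.X.residue_surjective _⟩
  have hs' : Function.Bijective (C'.X.residue (genericPoint C'.X)) :=
    ⟨RingHom.injective (C'.X.residue (genericPoint C'.X) : C'.X.functionField ⟶ _).hom,
      C'.X.residue_surjective _⟩
  refine Algebra.finrank_eq_of_equiv_equiv
    (RingEquiv.ofBijective (C.X.presheaf.stalkSpecializes (specializes_of_eq π.hom_genericPoint) ≫
      C.X.residue _).hom (hs _ π.hom_genericPoint))
    (RingEquiv.ofBijective (C'.X.residue (genericPoint C'.X)).hom hs') ?_
  have h := Scheme.residue_residueFieldMap π.hom (genericPoint C'.X)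
  have h2 : (C.X.presheaf.stalkSpecializes (specializes_of_eq π.hom_genericPoint) ≫
      C.X.residue _) ≫ π.hom.residueFieldMap (genericPoint C'.X) =
      π.functionFieldMap ≫ C'.X.residue (genericPoint C'.X) := by
    rw [Category.assoc, h, functionFieldMap, Category.assoc]
  ext a
  exact congr($h2 a)

end PointedCurve.Cover

end

/-! ### The degree in `τ` and ramification at infinity -/

section

namespace PointedCurve.Cover

variable {k : Type u} [Field k] [Finite k] {C' C : PointedCurve k} (π : Cover C' C)

/-- As `∞'` is the only point above `∞`, the degree of the covering is the product of the
ramification index `e` and the degree of the residue extension. -/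
theorem exists_ramification : ∃ e : ℕ, e * π.hom.residueDegree C'.pt = π.degree ∧
    ∀ f : C.X.functionField, f ≠ 0 →
      C'.X.ord (π.functionFieldMap f) C'.pt = e * C.X.ord f C.pt := by
  have hpt := π.hom_pt
  have : IsDiscreteValuationRing (C.X.presheaf.stalk (π.hom C'.pt)) := by
    rw [hpt]; infer_instance
  have hco : Order.coheight (π.hom C'.pt) = 1 := by rw [hpt]; exact C.coheight_pt
  have hfin := finite_stalkMap_of_isFinite π.hom C'.pt fun x' hx' =>
    (π.hom_eq_pt_iff x').mp (hx'.trans hpt)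
  let _ := π.functionFieldMap.hom.toAlgebra
  let _ := (π.hom.stalkMap C'.pt).hom.toAlgebra
  let _ : Algebra (C.X.presheaf.stalk (π.hom C'.pt)) C'.X.functionField :=
    ((algebraMap (C'.X.presheaf.stalk C'.pt) C'.X.functionField).comp
      (π.hom.stalkMap C'.pt).hom).toAlgebra
  have t1 : IsScalarTower (C.X.presheaf.stalk (π.hom C'.pt)) (C'.X.presheaf.stalk C'.pt)
    C'.X.functionField := IsScalarTower.of_algebraMap_eq' rfl
  have t2 : IsScalarTower (C.X.presheaf.stalk (π.hom C'.pt)) C.X.functionField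
    C'.X.functionField := IsScalarTower.of_algebraMap_eq fun a =>
      (π.functionFieldMap_algebraMap C'.pt a).symm
  have : Module.Finite (C.X.presheaf.stalk (π.hom C'.pt)) (C'.X.presheaf.stalk C'.pt) := hfin
  have hinj : Function.Injective (algebraMap (C.X.presheaf.stalk (π.hom C'.pt))
      (C'.X.presheaf.stalk C'.pt)) := by
    apply Function.Injective.of_comp (f := algebraMap (C'.X.presheaf.stalk C'.pt)
      C'.X.functionField)
    rw [← RingHom.coe_comp, ← IsScalarTower.algebraMap_eq, IsScalarTower.algebraMap_eq
      (C.X.presheaf.stalk (π.hom C'.pt)) C.X.functionField C'.X.functionField]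
    exact (RingHom.injective (algebraMap C.X.functionField C'.X.functionField)).comp
      (IsFractionRing.injective (C.X.presheaf.stalk (π.hom C'.pt)) C.X.functionField)
  have : FaithfulSMul (C.X.presheaf.stalk (π.hom C'.pt)) (C'.X.presheaf.stalk C'.pt) :=
    (faithfulSMul_iff_algebraMap_injective _ _).mpr hinj
  have : IsLocalHom (algebraMap (C.X.presheaf.stalk (π.hom C'.pt)) (C'.X.presheaf.stalk C'.pt)) :=
    inferInstanceAs (IsLocalHom (π.hom.stalkMap C'.pt).hom)
  obtain ⟨ϖ, hϖ⟩ := IsDiscreteValuationRing.exists_irreducible (C.X.presheaf.stalk (π.hom C'.pt))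
  obtain ⟨ϖ', hϖ'⟩ := IsDiscreteValuationRing.exists_irreducible (C'.X.presheaf.stalk C'.pt)
  obtain ⟨e, he⟩ := IsDiscreteValuationRing.associated_pow_irreducible
    (x := algebraMap (C.X.presheaf.stalk (π.hom C'.pt)) (C'.X.presheaf.stalk C'.pt) ϖ)
    (by rw [Ne, map_eq_zero_iff _ hinj]; exact hϖ.ne_zero) hϖ'
  refine ⟨e, ?_, fun f hf => ?_⟩
  · have h := mul_finrank_residueField_eq_finrank C.X.functionField C'.X.functionField hϖ hϖ' he
    rw [π.finrank_functionField] at h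
    rw [← h]
    congr 1
    let _ := (π.hom.residueFieldMap C'.pt).hom.toAlgebra
    refine Algebra.finrank_eq_of_equiv_equiv
      (RingEquiv.refl (IsLocalRing.ResidueField (C.X.presheaf.stalk (π.hom C'.pt))))
      (RingEquiv.refl (IsLocalRing.ResidueField (C'.X.presheaf.stalk C'.pt))) ?_
    refine Ideal.Quotient.ringHom_ext ?_
    ext x
    rfl
  · have h := ordFrac_map_eq π.functionFieldMap.hom (fun x => π.functionFieldMap_algebraMap C'.pt x)
      hϖ hϖ' he f hf
    have hf' : π.functionFieldMap f ≠ 0 := (map_ne_zero_iff _ π.functionFieldMap.hom.injective).mpr hf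
    have e1 : C.X.ord f C.pt = C.X.ord f (π.hom C'.pt) := by rw [hpt]
    rw [e1, Scheme.ord_eq_iff C'.coheight_pt hf']
    have h1 := (Scheme.ord_eq_iff hco hf (n := C.X.ord f (π.hom C'.pt))).mp rfl
    refine h.trans ?_
    rw [Scheme.ordHom] at h1
    erw [h1]
    rw [← WithZero.coe_pow, ← ofAdd_nsmul, nsmul_eq_mul]

/-- Restriction of coefficients from `A'` to `A` multiplies the rank by `n`: multiply `ord_∞'(π^* a) = e ord_∞(a)` by
`deg ∞' = f deg ∞` and use `e f = n`. -/
theorem tauDegree_coordMap (r' : ℕ) {a : C.coordRing} (ha : a ≠ 0) :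
    C'.tauDegree r' (π.coordMap a) = C.tauDegree (π.degree * r') a := by
  obtain ⟨e, he, hord⟩ := π.exists_ramification
  have h1 : C'.degInfty = C.degInfty * π.hom.residueDegree C'.pt := by
    have := residueDegree_comp π.hom C.str C'.pt
    rw [π.comp_str, π.hom_pt] at this
    exact this
  have h2 : C'.ordInfty (π.coordMap a) = e * C.ordInfty a := by
    have h3 := hord (C.X.germToFunctionField C.affinePart a)
      ((map_ne_zero_iff _ (Scheme.germToFunctionField_injective C.X C.affinePart)).mpr ha)
    have h4 := π.functionFieldMap_germ C.affinePart C'.affinePart π.affinePart_le a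
    rw [h4] at h3
    exact h3
  rw [tauDegree, tauDegree, h1, h2, ← he]
  congr 1
  push_cast
  ring

end PointedCurve.Cover

end

/-! ### Integrality of the coordinate ring of a cover -/

section

namespace PointedCurve.Cover

variable {k : Type u} [Field k] [Finite k] {C' C : PointedCurve k} (π : Cover C' C)

/-- A function on `C'` that is regular outside `∞'` is integral over each local ring of `C` at a point
different from `∞`, because `π` is finite. -/
theorem isIntegral_stalk (b : Γ(C'.X, C'.affinePart)) (x : C.X) (hx : x ∈ C.affinePart) :
    (π.functionFieldMap.hom.comp
      (algebraMap (C.X.presheaf.stalk x) C.X.functionField)).IsIntegralElem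
        (C'.X.germToFunctionField C'.affinePart b) := by
  obtain ⟨V, hV, hxV, hVU⟩ := exists_isAffineOpen_mem_and_subset hx
  have hle : π.hom ⁻¹ᵁ V ≤ C'.affinePart := fun x' hx' h => hVU hx' (by
    rw [Set.mem_singleton_iff.mp h]; exact π.hom_pt)
  have hV0 : Nonempty V := ⟨⟨x, hxV⟩⟩
  have hη : genericPoint C'.X ∈ π.hom ⁻¹ᵁ V := by
    change π.hom (genericPoint C'.X) ∈ V
    rw [π.hom_genericPoint]
    exact ((genericPoint_spec C.X).mem_open_set_iff V.isOpen).mpr ⟨x, trivial, hxV⟩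
  have hV0' : Nonempty (π.hom ⁻¹ᵁ V) := ⟨⟨_, hη⟩⟩
  have hfin : (π.hom.appLE V (π.hom ⁻¹ᵁ V) le_rfl).hom.Finite := by
    rw [← Scheme.Hom.app_eq_appLE]
    exact π.hom.finite_app V hV
  obtain ⟨p, hp, hpb⟩ := hfin.to_isIntegral (C'.X.presheaf.map (homOfLE hle).op b)
  have e1 : C'.X.germToFunctionField (π.hom ⁻¹ᵁ V) (C'.X.presheaf.map (homOfLE hle).op b) =
      C'.X.germToFunctionField C'.affinePart b :=
    TopCat.Presheaf.germ_res_apply _ _ _ _ _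
  refine ⟨p.map (C.X.presheaf.germ V x hxV).hom, hp.map _, ?_⟩
  have e2 : (π.functionFieldMap.hom.comp (algebraMap (C.X.presheaf.stalk x)
      C.X.functionField)).comp (C.X.presheaf.germ V x hxV).hom =
      (C'.X.germToFunctionField (π.hom ⁻¹ᵁ V)).hom.comp
        (π.hom.appLE V (π.hom ⁻¹ᵁ V) le_rfl).hom := by
    ext a
    have h1 := π.functionFieldMap_germ V (π.hom ⁻¹ᵁ V) le_rfl a
    rw [← Scheme.algebraMap_germ_eq_germToFunctionField C.X hxV] at h1
    exact h1
  rw [Polynomial.eval₂_map, e2, ← e1]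
  have := congr(C'.X.germToFunctionField (π.hom ⁻¹ᵁ V) $hpb)
  rw [map_zero] at this
  rw [← this]
  exact (Polynomial.hom_eval₂ _ _ _ _).symm

/-- `A'` is integral over `A`: the coefficients of the minimal polynomial over the function field of
`C` lie in all the integrally closed local rings outside `∞`. -/
theorem isIntegral_coordMap : π.coordMap.hom.IsIntegral := by
  intro b
  let b' : Γ(C'.X, C'.affinePart) := b
  let _ := π.functionFieldMap.hom.toAlgebra
  set β := C'.X.germToFunctionField C'.affinePart b' with hβ
  have hmin : ∀ x ∈ C.affinePart, ∃ p : Polynomial (C.X.presheaf.stalk x),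
      minpoly C.X.functionField β = p.map (algebraMap _ C.X.functionField) := fun x hx => by
    let _ : Algebra (C.X.presheaf.stalk x) C'.X.functionField :=
      (π.functionFieldMap.hom.comp (algebraMap (C.X.presheaf.stalk x) C.X.functionField)).toAlgebra
    have : IsScalarTower (C.X.presheaf.stalk x) C.X.functionField C'.X.functionField :=
      IsScalarTower.of_algebraMap_eq' rfl
    have : FaithfulSMul (C.X.presheaf.stalk x) C'.X.functionField :=
      (faithfulSMul_iff_algebraMap_injective _ _).mpr
        ((RingHom.injective π.functionFieldMap.hom).comp
          (IsFractionRing.injective (C.X.presheaf.stalk x) C.X.functionField))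
    exact ⟨_, minpoly.isIntegrallyClosed_eq_field_fractions' C.X.functionField
      (π.isIntegral_stalk b' x hx)⟩
  obtain ⟨x₀, hx₀⟩ := (inferInstance : Nonempty C.affinePart)
  have hint : IsIntegral C.X.functionField β := by
    obtain ⟨p, hp, hpb⟩ := π.isIntegral_stalk b' x₀ hx₀
    exact ⟨p.map _, hp.map _, by rw [Polynomial.eval₂_map]; exact hpb⟩
  have hl : minpoly C.X.functionField β ∈
      Polynomial.lifts (C.X.germToFunctionField C.affinePart).hom := by
    rw [Polynomial.lifts_iff_coeff_lifts]
    intro i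
    obtain ⟨a, ha⟩ := C.exists_germToFunctionField_eq C.affinePart
      ((minpoly C.X.functionField β).coeff i) fun x hx => by
        obtain ⟨p, hp⟩ := hmin x hx
        exact ⟨p.coeff i, by rw [hp, Polynomial.coeff_map]⟩
    exact ⟨a, ha⟩
  obtain ⟨p, hp, -, hm⟩ := Polynomial.lifts_and_natDegree_eq_and_monic hl (minpoly.monic hint)
  refine ⟨p, hm, ?_⟩
  have hinj := Scheme.germToFunctionField_injective C'.X C'.affinePart
  have e2 : π.functionFieldMap.hom.comp (C.X.germToFunctionField C.affinePart).hom =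
      (C'.X.germToFunctionField C'.affinePart).hom.comp
        (π.hom.appLE C.affinePart C'.affinePart π.affinePart_le).hom := by
    ext a
    exact π.functionFieldMap_germ C.affinePart C'.affinePart π.affinePart_le a
  have h0 : p.eval₂ (π.hom.appLE C.affinePart C'.affinePart π.affinePart_le).hom b' = 0 := by
    apply hinj
    rw [map_zero]
    refine (Polynomial.hom_eval₂ _ _ (C'.X.germToFunctionField C'.affinePart).hom _).trans ?_
    rw [← e2, ← Polynomial.eval₂_map, hp]
    exact minpoly.aeval _ _
  exact h0

end PointedCurve.Cover

end

/-! ### Group schemes isomorphic to the additive group -/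

section

open Polynomial

theorem pullFn_comp_SpecMap {A A' : CommRingCat.{u}} {S : Scheme.{u}} (c : S ⟶ Spec A')
    (α : A ⟶ A') (a : A) : pullFn (c ≫ Spec.map α) a = pullFn c (α a) := by
  have := Scheme.ΓSpecIso_inv_naturality α
  simp only [pullFn, Scheme.Hom.comp_appTop]
  exact congr(c.appTop.hom ($this a)).symm

/-- The structure map `R → Γ(T, 𝒪)` of a scheme `T` over `Spec R`. -/
def baseFn {R : Type u} [CommRing R] (T : Over (Spec (.of R))) : R →+* Γ(T.left, ⊤) :=
  pullFn T.hom

section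
variable {R : Type u} [CommRing R]

theorem appTop_eq_baseFn (T : Over (Spec (.of R))) (b : Γ(Spec (.of R), ⊤)) :
    T.hom.appTop b = baseFn T ((Scheme.ΓSpecIso (.of R)).hom b) := by
  simp [baseFn, pullFn]

theorem baseFn_map {T T' : Over (Spec (.of R))} (g : T' ⟶ T) (b : R) :
    g.left.appTop (baseFn T b) = baseFn T' b := by
  have h : g.left ≫ T.hom = T'.hom := Over.w g
  simp only [baseFn, ← h]
  exact (pullFn_comp _ _ _).symm

theorem baseFn_self (b : R) :
    baseFn (Over.mk (𝟙 (Spec (.of R)))) b = (Scheme.ΓSpecIso (.of R)).inv b := by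
  simp [baseFn, pullFn]

theorem baseFn_self_injective : Function.Injective (baseFn (Over.mk (𝟙 (Spec (.of R))))) := by
  intro a b h
  rw [baseFn_self, baseFn_self] at h
  exact (Scheme.ΓSpecIso (.of R)).symm.commRingCatIsoToRingEquiv.injective h

theorem baseFn_comp_ΓSpecIso_hom (T : Over (Spec (.of R))) :
    (baseFn T).comp (Scheme.ΓSpecIso (.of R)).hom.hom = T.hom.appTop.hom := by
  ext b; exact (appTop_eq_baseFn T b).symm

/-- A polynomial is determined by the maps it induces on the additive groups of the rings of
functions of all schemes over `Spec R`. -/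
theorem poly_ext_baseFn {F G : R[X]} (h : ∀ (T : Over (Spec (.of R))) (y : Γ(T.left, ⊤)),
    F.eval₂ (baseFn T) y = G.eval₂ (baseFn T) y) : F = G := by
  let i : R →+* Γ(Spec (.of R), ⊤) := (Scheme.ΓSpecIso (.of R)).inv.hom
  have hi : Function.Injective i :=
    (Scheme.ΓSpecIso (.of R)).symm.commRingCatIsoToRingEquiv.injective
  refine Polynomial.map_injective i hi (GaIso.poly_ext (U := Spec (.of R)) _ _ fun T t y => ?_)
  rw [eval₂_map, eval₂_map]
  exact h (Over.mk t) y

/-- A functorial map between additive groups of rings of functions is given by a polynomial. -/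
theorem exists_poly_baseFn
    (Φ : ∀ T : Over (Spec (.of R)), Γ(T.left, ⊤) → Γ(T.left, ⊤))
    (hΦ : ∀ {T T' : Over (Spec (.of R))} (g : T' ⟶ T) (y : Γ(T.left, ⊤)),
      Φ T' (g.left.appTop y) = g.left.appTop (Φ T y)) :
    ∃ F : R[X], ∀ (T : Over (Spec (.of R))) (y : Γ(T.left, ⊤)),
      Φ T y = F.eval₂ (baseFn T) y := by
  obtain ⟨F, hF⟩ := GaIso.exists_poly (U := Spec (.of R)) (fun T t y => Φ (Over.mk t) y)
    fun T T' t g y => hΦ (T := Over.mk t) (T' := Over.mk (g ≫ t)) (Over.homMk g) y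
  refine ⟨F.map (Scheme.ΓSpecIso (.of R)).hom.hom, fun T y => ?_⟩
  rw [eval₂_map, baseFn_comp_ΓSpecIso_hom]
  exact hF T.left T.hom y

end

/-- An isomorphism of the group scheme `E` over `Spec R` with the additive group `𝔾_a`, in which
`a : A` acts by the polynomial `P a`. -/
structure GaAction {A : CommRingCat.{u}} {R : Type u} [CommRing R]
    (E : ModuleScheme A (Spec (.of R))) (P : A → R[X]) where
  toEquiv (T : Over (Spec (.of R))) : E.points.obj (op T) ≃+ Γ(T.left, ⊤)
  naturality {T T' : Over (Spec (.of R))} (g : T' ⟶ T) (x : E.points.obj (op T)) :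
    toEquiv T' (E.points.map g.op x) = g.left.appTop (toEquiv T x)
  map_smul (a : A) (T : Over (Spec (.of R))) (x : E.points.obj (op T)) :
    toEquiv T (a • x) = (P a).eval₂ (baseFn T) (toEquiv T x)

namespace GaAction

variable {A A' : CommRingCat.{u}} {R : Type u} [CommRing R]

section
variable {E E' : ModuleScheme A (Spec (.of R))} {P P' : A → R[X]}

theorem symm_naturality (e : GaAction E P) {T T' : Over (Spec (.of R))} (g : T' ⟶ T)
    (y : Γ(T.left, ⊤)) :
    (e.toEquiv T').symm (g.left.appTop y) = E.points.map g.op ((e.toEquiv T).symm y) := by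
  rw [AddEquiv.symm_apply_eq, e.naturality, AddEquiv.apply_symm_apply]

theorem isPolyAction (e : GaAction E P) : IsPolyAction P where
  add a b := poly_ext_baseFn fun T y => by
    obtain ⟨x, rfl⟩ := (e.toEquiv T).surjective y
    rw [eval₂_add, ← e.map_smul, ← e.map_smul, ← e.map_smul, add_smul, map_add]
  mul a b := poly_ext_baseFn fun T y => by
    obtain ⟨x, rfl⟩ := (e.toEquiv T).surjective y
    rw [eval₂_comp, ← e.map_smul, ← e.map_smul, ← e.map_smul, mul_smul]
  one := poly_ext_baseFn fun T y => by
    obtain ⟨x, rfl⟩ := (e.toEquiv T).surjective y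
    rw [← e.map_smul, one_smul, eval₂_X]
  coeff_zero a := by
    have := e.map_smul a (Over.mk (𝟙 _)) 0
    rw [smul_zero, map_zero, eval₂_at_zero] at this
    exact baseFn_self_injective (by rw [← this, map_zero])

/-- Base change along `Spec S → Spec R`. -/
def pullback {S : Type u} [CommRing S] (e : GaAction E P) (f : R →+* S) :
    GaAction (E.pullback (Spec.map (CommRingCat.ofHom f))) fun a => (P a).map f where
  toEquiv T := e.toEquiv ((Over.map (Spec.map (CommRingCat.ofHom f))).obj T)
  naturality g x := e.naturality ((Over.map (Spec.map (CommRingCat.ofHom f))).map g) x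
  map_smul a T x := by
    rw [eval₂_map]
    refine (e.map_smul a _ x).trans ?_
    congr 1
    ext b
    exact pullFn_comp_SpecMap T.hom (CommRingCat.ofHom f) b

/-- A coordinate for a module scheme is a coordinate for its restriction of scalars. -/
def restrictScalars {E : ModuleScheme A' (Spec (.of R))} {P : A' → R[X]} (e : GaAction E P)
    (α : A ⟶ A') : GaAction (E.restrictScalars α) fun a => P (α a) where
  toEquiv T := e.toEquiv T
  naturality g x := e.naturality g x
  map_smul a T x := e.map_smul (α a) T x

/-- Multiplication by a unit that intertwines the actions is an isomorphism. -/
theorem isomorphic (e : GaAction E P) (e' : GaAction E' P') (v : Rˣ)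
    (h : ∀ a, (P' a).comp (C (v : R) * X) = C (v : R) * P a) : E.Isomorphic E' := by
  let m (T : Over (Spec (.of R))) : Γ(T.left, ⊤) ≃+ Γ(T.left, ⊤) :=
    { toFun := fun y => baseFn T v * y
      invFun := fun y => baseFn T ((v⁻¹ : Rˣ) : R) * y
      left_inv := fun y => by beta_reduce; rw [← mul_assoc, ← map_mul]; simp
      right_inv := fun y => by beta_reduce; rw [← mul_assoc, ← map_mul]; simp
      map_add' := fun y z => mul_add _ _ _ }
  let f (T : Over (Spec (.of R))) : E.points.obj (op T) ≃ₗ[A] E'.points.obj (op T) :=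
    { ((e.toEquiv T).trans (m T)).trans (e'.toEquiv T).symm with
      map_smul' := fun a x => by
        change (e'.toEquiv T).symm (baseFn T v * e.toEquiv T (a • x)) =
          a • (e'.toEquiv T).symm (baseFn T v * e.toEquiv T x)
        rw [AddEquiv.symm_apply_eq, e'.map_smul, AddEquiv.apply_symm_apply, e.map_smul]
        have := congr(Polynomial.eval₂ (baseFn T) (e.toEquiv T x) $(h a))
        rw [eval₂_comp, eval₂_mul, eval₂_mul, eval₂_C, eval₂_X] at this
        exact this.symm }
  refine ⟨NatIso.ofComponents (fun T => (f T.unop).toModuleIso) fun {T T'} g => ?_⟩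
  ext x
  change (e'.toEquiv T'.unop).symm (baseFn T'.unop v * e.toEquiv T'.unop (E.points.map g x)) =
    E'.points.map g ((e'.toEquiv T.unop).symm (baseFn T.unop v * e.toEquiv T.unop x))
  have h1 := e.naturality g.unop x
  have h2 := e'.symm_naturality g.unop (baseFn T.unop v * e.toEquiv T.unop x)
  rw [map_mul, baseFn_map, ← h1] at h2
  exact h2

/-- In coordinates over a domain, every isomorphism is multiplication by a unit. -/
theorem exists_unit [IsDomain R] (e : GaAction E P) (e' : GaAction E' P')
    (h : E.Isomorphic E') : ∃ v : Rˣ, ∀ a, (P' a).comp (C (v : R) * X) = C (v : R) * P a := by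
  obtain ⟨i⟩ := h
  have hn : ∀ {T T' : Over (Spec (.of R))} (g : T' ⟶ T) (x : E.points.obj (op T)),
      i.hom.app (op T') (E.points.map g.op x) = E'.points.map g.op (i.hom.app (op T) x) :=
    fun g x => congr($(i.hom.naturality g.op) x)
  have hn' : ∀ {T T' : Over (Spec (.of R))} (g : T' ⟶ T) (x : E'.points.obj (op T)),
      i.inv.app (op T') (E'.points.map g.op x) = E.points.map g.op (i.inv.app (op T) x) :=
    fun g x => congr($(i.inv.naturality g.op) x)
  obtain ⟨v, hv⟩ := exists_poly_baseFn
    (fun T y => e'.toEquiv T (i.hom.app (op T) ((e.toEquiv T).symm y))) fun g y => by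
      rw [e.symm_naturality, hn, e'.naturality]
  obtain ⟨w, hw⟩ := exists_poly_baseFn
    (fun T y => e.toEquiv T (i.inv.app (op T) ((e'.toEquiv T).symm y))) fun g y => by
      rw [e'.symm_naturality, hn', e.naturality]
  have hvw : v.comp w = X := poly_ext_baseFn fun T y => by
    rw [eval₂_comp, ← hw, ← hv, AddEquiv.symm_apply_apply, eval₂_X]
    have := congr($(i.inv_hom_id_app (op T)) ((e'.toEquiv T).symm y))
    exact ((e'.toEquiv T).eq_symm_apply).mp this
  have hv0 : v.coeff 0 = 0 := by
    have := hv (Over.mk (𝟙 _)) 0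
    rw [eval₂_at_zero] at this
    simp only [map_zero] at this
    exact baseFn_self_injective (by rw [← this, map_zero])
  have hd : v.natDegree * w.natDegree = 1 := by
    rw [← natDegree_comp, hvw, natDegree_X]
  have hv1 := eq_C_mul_X_of_natDegree_le_one (Nat.eq_one_of_mul_eq_one_right hd).le hv0
  have hu : v.coeff 1 * w.coeff 1 = 1 := by
    rw [hv1] at hvw
    simpa using congr(($hvw).coeff 1)
  refine ⟨Units.mkOfMulEqOne _ _ hu, fun a => ?_⟩
  rw [Units.val_mkOfMulEqOne, ← hv1]
  conv_rhs => rw [show C (v.coeff 1) * P a = v.comp (P a) by rw [hv1]; simp]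
  refine poly_ext_baseFn fun T y => ?_
  obtain ⟨x, rfl⟩ := (e.toEquiv T).surjective y
  rw [eval₂_comp, eval₂_comp, ← e.map_smul, ← hv, ← hv, AddEquiv.symm_apply_apply,
    AddEquiv.symm_apply_apply, ← e'.map_smul, LinearMap.map_smul]

end

/-- The points of the additive group over `T`, with `a : A` acting by the polynomial `P a`. -/
abbrev pointsModule {P : A → R[X]} (hP : IsPolyAction P) (T : Over (Spec (.of R)))
    (h : ∀ a (y z : Γ(T.left, ⊤)), (P a).eval₂ (baseFn T) (y + z) =
      (P a).eval₂ (baseFn T) y + (P a).eval₂ (baseFn T) z) : Module A Γ(T.left, ⊤) where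
  smul a y := (P a).eval₂ (baseFn T) y
  one_smul y := by change (P 1).eval₂ _ y = y; rw [hP.one, eval₂_X]
  mul_smul a b y := by change (P (a * b)).eval₂ _ y = _; rw [hP.mul, eval₂_comp]; rfl
  smul_zero a := by
    change (P a).eval₂ _ 0 = 0
    rw [eval₂_at_zero, hP.coeff_zero, map_zero]
  smul_add a := h a
  add_smul a b y := by change (P (a + b)).eval₂ _ y = _; rw [hP.add, eval₂_add]; rfl
  zero_smul y := by change (P 0).eval₂ _ y = _; rw [hP.zero, eval₂_zero]

/-- Every ring of additive polynomials indexed by `A` comes from an `A`-module scheme. The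
representability of the additive group is taken from a given isomorphism with it. -/
theorem exists_moduleScheme {P₀ : A → R[X]} {E₀ : ModuleScheme A (Spec (.of R))}
    (e₀ : GaAction E₀ P₀) {P : A' → R[X]} (hP : IsPolyAction P)
    (h : ∀ a (T : Over (Spec (.of R))) (y z : Γ(T.left, ⊤)), (P a).eval₂ (baseFn T) (y + z) =
      (P a).eval₂ (baseFn T) y + (P a).eval₂ (baseFn T) z) :
    ∃ E : ModuleScheme A' (Spec (.of R)), Nonempty (GaAction E P) := by
  let m (T : Over (Spec (.of R))) : Module A' Γ(T.left, ⊤) :=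
    pointsModule hP T fun a => h a T
  let F : (Over (Spec (.of R)))ᵒᵖ ⥤ ModuleCat.{u} A' :=
    { obj := fun T => ModuleCat.of A' Γ(T.unop.left, ⊤)
      map := fun {T T'} g => ModuleCat.ofHom
        { toFun := g.unop.left.appTop
          map_add' := map_add _
          map_smul' := fun a y => by
            change g.unop.left.appTop ((P a).eval₂ (baseFn T.unop) y) =
              (P a).eval₂ (baseFn T'.unop) (g.unop.left.appTop y)
            refine (hom_eval₂ _ _ g.unop.left.appTop.hom y).trans ?_
            congr 1
            ext b
            exact baseFn_map g.unop b }
      map_id := fun T => by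
        ext y
        change (𝟙 T.unop.left : T.unop.left ⟶ _).appTop y = y
        simp
      map_comp := fun f g => by
        ext y
        exact appTop_comp_apply g.unop.left f.unop.left y }
  have i : E₀.points ⋙ forget (ModuleCat.{u} A) ≅ F ⋙ forget (ModuleCat.{u} A') :=
    NatIso.ofComponents (fun T => (e₀.toEquiv T.unop).toEquiv.toIso) fun g => by
      ext x
      exact e₀.naturality g.unop x
  have := E₀.representable
  refine ⟨⟨F, isRepresentable_of_natIso _ i⟩, ⟨⟨fun T => AddEquiv.refl _, fun g x => rfl,
    fun a T x => rfl⟩⟩⟩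

end GaAction

end

/-! ### Drinfeld modules over local domains -/

section

open Polynomial

theorem natDegree_tauPoly {B : Type u} [CommRing B] {q : ℕ} (hq : 2 ≤ q) {δ : ℕ →₀ B} {d : ℕ}
    (hd : δ d ≠ 0) (h : ∀ i, d < i → δ i = 0) : (tauPoly q δ).natDegree = q ^ d := by
  refine natDegree_eq_of_le_of_coeff_ne_zero (natDegree_sum_le_of_forall_le _ _ fun i hi => ?_)
    (by rwa [tauPoly_coeff hq])
  refine (natDegree_C_mul_X_pow_le _ _).trans (Nat.pow_le_pow_right (by omega) ?_)
  by_contra hid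
  exact Finsupp.mem_support_iff.mp hi (h i (not_le.mp hid))

theorem eval₂_tauPoly_add {k : Type u} [Field k] [Finite k] {B D : Type u} [CommRing B] [CommRing D]
    (κ : k →+* B) (f : B →+* D) (δ : ℕ →₀ B) (y z : D) :
    (tauPoly (Nat.card k) δ).eval₂ f (y + z) =
      (tauPoly (Nat.card k) δ).eval₂ f y + (tauPoly (Nat.card k) δ).eval₂ f z := by
  rcases subsingleton_or_nontrivial D with hD | hD
  · exact Subsingleton.elim _ _
  cases nonempty_fintype k
  obtain ⟨p, _⟩ := CharP.exists k
  obtain ⟨e, hp, hq⟩ := FiniteField.card k p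
  have : Fact p.Prime := ⟨hp⟩
  have : CharP D p := charP_of_injective_ringHom (f.comp κ).injective p
  rw [Nat.card_eq_fintype_card, hq]
  simp only [tauPoly_eval₂, ← pow_mul, add_pow_char_pow, mul_add, Finsupp.sum_add]

/-- The polynomials by which a Drinfeld module over a domain `R` acts in a coordinate, where
`f : A → R` is the characteristic and `d` prescribes the degrees in `τ`. -/
structure IsDrinfeldAction {k : Type u} [Field k] {A R : Type u} [CommRing A] [CommRing R]
    (ι : k →+* A) (d : A → ℕ) (f : A →+* R) (P : A → R[X]) : Prop extends IsPolyAction P where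
  coeff_one (a : A) : (P a).coeff 1 = f a
  constants (ζ : k) : P (ι ζ) = C (f (ι ζ)) * X
  exists_tauPoly (a : A) : ∃ δ, P a = tauPoly (Nat.card k) δ
  natDegree {a : A} (ha : a ≠ 0) : (P a).natDegree = Nat.card k ^ d a
  isUnit {a : A} (ha : a ≠ 0) : IsUnit (P a).leadingCoeff

section
variable {k : Type u} [Field k] [Finite k] {A : CommRingCat.{u}} {R : Type u} [CommRing R]
  {ι : k →+* A} {d : A → ℕ} {E : ModuleScheme A (Spec (.of R))}

theorem baseFn_apply_eq {T : Over (Spec (.of R))} (f : A →+* R) (a : A) :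
    pullFn (T.hom ≫ Spec.map (CommRingCat.ofHom f)) a = baseFn T (f a) :=
  pullFn_comp_SpecMap T.hom (CommRingCat.ofHom f) a

/-- Over a local domain a Drinfeld module is isomorphic to the additive group, acted upon by
polynomials whose leading coefficients are units. -/
theorem IsDrinfeld.exists_gaAction [IsDomain R] [IsLocalRing R] {f : A →+* R}
    (H : IsDrinfeld ι d (Spec.map (CommRingCat.ofHom f)) E) :
    ∃ P, IsDrinfeldAction ι d f P ∧ Nonempty (GaAction E P) := by
  have hq : 2 ≤ Nat.card k := Finite.one_lt_card
  let S := Spec (CommRingCat.of R)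
  -- the only open neighbourhood of the closed point is the whole spectrum
  obtain ⟨U, hU, ⟨ψ₀⟩⟩ := H.locallyGa (IsLocalRing.closedPoint R)
  have hUt : U = ⊤ := by
    ext x
    exact iff_of_true ((IsLocalRing.specializes_closedPoint x).mem_open U.isOpen hU) trivial
  subst hUt
  let ψ : GaIso ι (Spec.map (CommRingCat.ofHom f)) E (𝟙 S) :=
    ψ₀.restrict S.topIso.inv (𝟙 S) (by simp [← Scheme.topIso_hom])
  have hψ : ∀ a ≠ 0, ψ.HasExpansion a (d a) := fun a ha =>
    (H.expansion ⊤ (isAffineOpen_top _) ψ₀ a ha).restrict _ _ _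
  choose F hF using fun a => ψ.exists_actPoly ψ a
  choose δ hδ using fun a => ψ.tauPoly_of_actPoly (hF a)
  let i : Γ(S, ⊤) →+* R := (Scheme.ΓSpecIso (.of R)).hom.hom
  have hi : Function.Injective i := (Scheme.ΓSpecIso (.of R)).commRingCatIsoToRingEquiv.injective
  have hmap : ∀ δ' : ℕ →₀ Γ(S, ⊤), (tauPoly (Nat.card k) δ').map i =
      tauPoly (Nat.card k) (δ'.mapRange i (map_zero i)) := fun δ' => by
    rw [tauPoly, tauPoly, Finsupp.sum_mapRange_index (by simp), Finsupp.sum, Polynomial.map_sum]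
    simp [Finsupp.sum]
  let e : GaAction E fun a => (F a).map i :=
    { toEquiv := fun T => ψ.toEquiv T T.hom (Category.comp_id _)
      naturality := fun {T T'} g x => by
        have h := ψ.naturality g T.hom (Category.comp_id _) (by simp) x
        convert h using 3
        exact (Over.w g).symm
      map_smul := fun a T x => by
        rw [eval₂_map, baseFn_comp_ΓSpecIso_hom]
        exact hF a T T.hom (Category.comp_id _) x }
  -- the shape of the action polynomials
  have key : ∀ a ≠ 0, ∃ δ' : ℕ →₀ R, (F a).map i = tauPoly (Nat.card k) δ' ∧ δ' 0 = f a ∧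
      IsUnit (δ' (d a)) ∧ ∀ j, d a < j → δ' j = 0 := fun a ha => by
    obtain ⟨δ', h1, h2, h3, h4⟩ := hψ a ha
    have hFa : F a = tauPoly (Nat.card k) δ' := GaIso.poly_ext _ _ fun T t y => by
      obtain ⟨x, rfl⟩ := (ψ.at' t).surjective y
      rw [tauPoly_eval₂]
      exact (hF a (Over.mk (t ≫ 𝟙 S)) t rfl x).symm.trans (h1 (Over.mk (t ≫ 𝟙 S)) t rfl x)
    refine ⟨δ'.mapRange i (map_zero i), by rw [hFa, hmap], ?_, ?_, fun j hj => ?_⟩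
    · rw [Finsupp.mapRange_apply, h2]
      have : pullFn (𝟙 S ≫ Spec.map (CommRingCat.ofHom f)) a = _ :=
        baseFn_apply_eq (T := Over.mk (𝟙 S)) f a
      rw [this, baseFn_self]
      simp [i]
    · rw [Finsupp.mapRange_apply]; exact h3.map i
    · rw [Finsupp.mapRange_apply]; exact ((h4 j hj).map i).eq_zero
  refine ⟨_, { e.isPolyAction with
    coeff_one := fun a => ?_
    constants := fun ζ => ?_
    exists_tauPoly := fun a => ⟨_, by rw [hδ a, hmap]⟩
    natDegree := fun {a} ha => ?_
    isUnit := fun {a} ha => ?_ }, ⟨e⟩⟩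
  · rcases eq_or_ne a 0 with rfl | ha
    · rw [e.isPolyAction.zero]; simp
    · obtain ⟨δ', h1, h2, -⟩ := key a ha
      rw [h1, ← h2, ← tauPoly_coeff hq δ' 0, pow_zero]
  · refine poly_ext_baseFn fun T y => ?_
    obtain ⟨x, rfl⟩ := (e.toEquiv T).surjective y
    rw [← e.map_smul, eval₂_mul, eval₂_C, eval₂_X, ← baseFn_apply_eq]
    exact ψ.map_smul T T.hom (Category.comp_id _) ζ x
  · obtain ⟨δ', h1, -, h3, h4⟩ := key a ha
    rw [h1, natDegree_tauPoly hq h3.ne_zero h4]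
  · obtain ⟨δ', h1, -, h3, h4⟩ := key a ha
    rwa [h1, leadingCoeff, natDegree_tauPoly hq h3.ne_zero h4, tauPoly_coeff hq]

/-- Polynomials of the right shape define a Drinfeld module. -/
theorem GaAction.isDrinfeld {P : A → R[X]} (e : GaAction E P) {f : A →+* R}
    (hP : IsDrinfeldAction ι d f P) : IsDrinfeld ι d (Spec.map (CommRingCat.ofHom f)) E := by
  have hq : 2 ≤ Nat.card k := Finite.one_lt_card
  let S := Spec (CommRingCat.of R)
  let ψ : GaIso ι (Spec.map (CommRingCat.ofHom f)) E (𝟙 S) :=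
    { toEquiv := fun T _ _ => e.toEquiv T
      naturality := fun g _ _ _ x => e.naturality g x
      map_smul := fun T _ _ ζ x => by
        rw [e.map_smul, hP.constants, eval₂_mul, eval₂_C, eval₂_X, ← baseFn_apply_eq] }
  let i : R →+* Γ(S, ⊤) := (Scheme.ΓSpecIso (.of R)).inv.hom
  have hψ : ∀ a ≠ 0, ψ.HasExpansion a (d a) := fun a ha => by
    obtain ⟨δ, hδ⟩ := hP.exists_tauPoly a
    refine ⟨δ.mapRange i (map_zero i), fun T t ht x => ?_, ?_, ?_, fun j hj => ?_⟩
    · obtain rfl : t = T.hom := by simpa using ht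
      rw [Finsupp.sum_mapRange_index (by simp)]
      refine (e.map_smul a T x).trans ?_
      rw [hδ, tauPoly_eval₂]
      rfl
    · have : pullFn (𝟙 S ≫ Spec.map (CommRingCat.ofHom f)) a = _ :=
        baseFn_apply_eq (T := Over.mk (𝟙 S)) f a
      rw [this, baseFn_self, Finsupp.mapRange_apply, ← hP.coeff_one, hδ,
        ← tauPoly_coeff hq δ 0, pow_zero]
    · rw [Finsupp.mapRange_apply, ← tauPoly_coeff hq δ, ← hδ, ← hP.natDegree ha]
      exact (hP.isUnit ha).map i
    · rw [Finsupp.mapRange_apply, ← tauPoly_coeff hq δ, ← hδ, coeff_eq_zero_of_natDegree_lt,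
        map_zero]
      · exact IsNilpotent.zero
      · rw [hP.natDegree ha]; exact Nat.pow_lt_pow_right hq hj
  refine ⟨fun s => ⟨⊤, trivial, ⟨ψ.restrict (Scheme.Opens.ι ⊤) _ (Category.comp_id _)⟩⟩,
    fun U hU ψ' a ha => ?_⟩
  have : IsAffine U := hU
  exact GaIso.HasExpansion.of_locally ψ' a _ fun x => ⟨⊤, trivial,
    ψ.restrict (Scheme.Opens.ι ⊤) _ (Category.comp_id _), (hψ a ha).restrict _ _ _⟩

end

/-! ### Restriction of coefficients -/

namespace PointedCurve.Cover

variable {k : Type u} [Field k] {C' C : PointedCurve k} (π : Cover C' C)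

theorem coordMap_constants (ζ : k) : π.coordMap (C.constants ζ) = C'.constants ζ := by
  have h : C.str.appLE ⊤ C.affinePart le_top ≫ π.coordMap =
      C'.str.appLE ⊤ C'.affinePart le_top := by
    refine (Scheme.Hom.appLE_comp_appLE π.hom C.str ⊤ C.affinePart C'.affinePart le_top
      π.affinePart_le).trans ?_
    simp only [π.comp_str]
  exact congr($h ((Scheme.ΓSpecIso (.of k)).inv ζ))

end PointedCurve.Cover

section
variable {k : Type u} [Field k] {C' C : PointedCurve k} (π : PointedCurve.Cover C' C)
  {S U : Scheme.{u}} {c' : S ⟶ Spec C'.coordRing} {E : ModuleScheme C'.coordRing S} {j : U ⟶ S}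

/-- Coordinates of a module scheme are coordinates of its restriction of scalars. -/
def GaIso.restrictScalars (ψ : GaIso C'.constants c' E j) :
    GaIso C.constants (c' ≫ Spec.map π.coordMap) (E.restrictScalars π.coordMap) j where
  toEquiv T t ht := ψ.toEquiv T t ht
  naturality g t ht ht' x := ψ.naturality g t ht ht' x
  map_smul T t ht ζ x := by
    rw [← Category.assoc, pullFn_comp_SpecMap, π.coordMap_constants]
    refine Eq.trans ?_ (ψ.map_smul T t ht ζ x)
    rw [← π.coordMap_constants]
    rfl

/-- Coordinates of the restriction of scalars are coordinates of the original module scheme. -/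
def GaIso.ofRestrictScalars
    (ψ : GaIso C.constants (c' ≫ Spec.map π.coordMap) (E.restrictScalars π.coordMap) j) :
    GaIso C'.constants c' E j where
  toEquiv T t ht := ψ.toEquiv T t ht
  naturality g t ht ht' x := ψ.naturality g t ht ht' x
  map_smul T t ht ζ x := by
    have := ψ.map_smul T t ht ζ x
    rw [← Category.assoc, pullFn_comp_SpecMap, π.coordMap_constants] at this
    refine Eq.trans ?_ this
    rw [← π.coordMap_constants]
    rfl

theorem IsDrinfeld.restrictScalars [Finite k] {r' : ℕ}
    (H : IsDrinfeld C'.constants (C'.tauDegree r') c' E) :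
    IsDrinfeld C.constants (C.tauDegree (π.degree * r')) (c' ≫ Spec.map π.coordMap)
      (E.restrictScalars π.coordMap) where
  locallyGa s := by
    obtain ⟨U, hU, ⟨ψ⟩⟩ := H.locallyGa s
    exact ⟨U, hU, ⟨ψ.restrictScalars π⟩⟩
  expansion U hU ψ a ha := by
    obtain ⟨δ, h1, h2, h3, h4⟩ := H.expansion U hU (ψ.ofRestrictScalars π) (π.coordMap a)
      fun h => ha (π.coordMap_injective (h.trans (map_zero _).symm))
    rw [π.tauDegree_coordMap r' ha] at h3 h4
    refine ⟨δ, fun T t ht x => h1 T t ht x, ?_, h3, h4⟩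
    rw [h2, ← Category.assoc, pullFn_comp_SpecMap]

end

section
variable {k : Type u} [Field k] [Finite k] {C' C : PointedCurve k} (π : PointedCurve.Cover C' C)
  (r' : ℕ)

/-- Restriction of coefficients of Drinfeld modules along a cover. -/
def DrinfeldModule.restrictScalars {r' : ℕ} {S : Scheme.{u}} (M : DrinfeldModule C' r' S) :
    DrinfeldModule C (π.degree * r') S where
  char := M.char ≫ Spec.map π.coordMap
  toModuleScheme := M.toModuleScheme.restrictScalars π.coordMap
  isDrinfeld := M.isDrinfeld.restrictScalars π

/-- Restriction of coefficients as a morphism of moduli functors. -/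
def moduliRestrict : moduli C' r' ⟶ moduli C (π.degree * r') where
  app S := TypeCat.ofHom (Quotient.map (fun M => M.restrictScalars π) fun M N ⟨h, ⟨e⟩⟩ =>
    ⟨congrArg (· ≫ Spec.map π.coordMap) h, ⟨Functor.isoWhiskerRight e _⟩⟩)
  naturality S S' f := by
    ext x
    induction x using Quotient.inductionOn with | _ M
    exact Quotient.sound ⟨Category.assoc _ _ _, ⟨Iso.refl _⟩⟩

theorem isRestrictionOfCoefficients : IsRestrictionOfCoefficients π (moduliRestrict π r') :=
  fun _ M => ⟨M.restrictScalars π, rfl, rfl, rfl⟩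

end

end

/-! ### The valuative criterion -/

section

open Polynomial

variable {k : Type u} [Field k] [Finite k] {C' C : PointedCurve k}

theorem DrinfeldModule.exists_gaAction {r : ℕ} {R : Type u} [CommRing R] [IsDomain R]
    [IsLocalRing R] (M : DrinfeldModule C r (Spec (.of R))) :
    ∃ (f : C.coordRing →+* R) (P : C.coordRing → R[X]),
      M.char = Spec.map (CommRingCat.ofHom f) ∧
      IsDrinfeldAction C.constants (C.tauDegree r) f P ∧
      Nonempty (GaAction M.toModuleScheme P) := by
  obtain ⟨c, E, H⟩ := M
  obtain ⟨f, rfl⟩ := Spec.map_surjective c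
  have H' : IsDrinfeld C.constants (C.tauDegree r) (Spec.map (CommRingCat.ofHom f.hom)) E := H
  obtain ⟨P, hP, he⟩ := H'.exists_gaAction
  exact ⟨f.hom, P, rfl, hP, he⟩

variable (π : PointedCurve.Cover C' C) (r' : ℕ)

theorem valuativeCriterion_moduliRestrict : ValuativeCriterion (moduliRestrict π r') := by
  intro R K _ _ _ _ _ _ x y hxy
  have hq : 2 ≤ Nat.card k := Finite.one_lt_card
  let φ := algebraMap R K
  have hφ : Function.Injective φ := IsFractionRing.injective R K
  have hinj : Function.Injective (Polynomial.map φ) := Polynomial.map_injective φ hφ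
  induction x using Quotient.inductionOn with | _ N
  induction y using Quotient.inductionOn with | _ M
  refine existsUnique_of_exists_of_unique ?_ ?_
  · obtain ⟨hc, hiso⟩ := Quotient.exact hxy
    obtain ⟨fN, Q₀, hN, hQ₀, ⟨eN⟩⟩ := N.exists_gaAction
    obtain ⟨fM, P, hM, hP, ⟨eM⟩⟩ := M.exists_gaAction
    obtain ⟨u, hu⟩ := (eN.restrictScalars π.coordMap).exists_unit (eM.pullback φ) hiso
    -- the coordinate of `x` is rescaled so as to be that of `y` on the generic fibre
    obtain ⟨Q, hQ, hQdef⟩ : ∃ Q, IsPolyAction Q ∧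
        ∀ b, Q b = Polynomial.C (u : K) * (Q₀ b).comp (Polynomial.C ((u⁻¹ : Kˣ) : K) * X) :=
      ⟨_, hQ₀.toIsPolyAction.conj u, fun _ => rfl⟩
    have hQu : ∀ b, (Q b).comp (Polynomial.C (u : K) * X) = Polynomial.C (u : K) * Q₀ b := fun b => by
      simp [hQdef, comp_assoc, ← mul_assoc, ← C_mul]
    have hcancel : ∀ F G : K[X], F.comp (Polynomial.C (u : K) * X) = G.comp (Polynomial.C (u : K) * X) → F = G :=
      fun F G h => by
        have := congr(($h).comp (Polynomial.C ((u⁻¹ : Kˣ) : K) * X))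
        simpa [comp_assoc, ← mul_assoc, ← C_mul] using this
    have hPQ : ∀ a, Q (π.coordMap a) = (P a).map φ := fun a =>
      hcancel _ _ ((hQu _).trans (hu a).symm)
    have hcoeff : ∀ b n, (Q b).coeff n * (u : K) ^ n = u * (Q₀ b).coeff n := fun b n => by
      rw [← comp_C_mul_X_coeff, hQu, coeff_C_mul]
    have hdeg : ∀ b, (Q b).natDegree = (Q₀ b).natDegree := fun b => by
      have := congr(natDegree $(hQu b))
      rwa [natDegree_comp, natDegree_C_mul_X _ u.ne_zero, mul_one,
        natDegree_C_mul u.ne_zero] at this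
    have : IsDomain C'.coordRing := inferInstanceAs (IsDomain Γ(C'.X, C'.affinePart))
    let _ : Algebra C.coordRing C'.coordRing := π.coordMap.hom.toAlgebra
    have : Algebra.IsIntegral C.coordRing C'.coordRing := ⟨π.isIntegral_coordMap⟩
    have hlift : ∀ b, ∃ f : R[X], f.map φ = Q b ∧ (b ≠ 0 → IsUnit f.leadingCoeff) := fun b => by
      rcases eq_or_ne b 0 with rfl | hb
      · exact ⟨0, by rw [hQ.zero, Polynomial.map_zero], fun h => absurd rfl h⟩
      · obtain ⟨f, h1, h2⟩ := IsPolyAction.exists_lift hQ hPQ (fun a ha => hP.isUnit ha)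
          (fun b hb => by rw [hdeg, hQ₀.natDegree hb]; positivity) hb
        exact ⟨f, h1, fun _ => h2⟩
    choose Φ hΦ hΦu using hlift
    have hΦP : IsPolyAction Φ :=
      { add := fun a b => hinj (by simp only [Polynomial.map_add, hΦ, hQ.add])
        mul := fun a b => hinj (by simp only [Polynomial.map_comp, hΦ, hQ.mul])
        one := hinj (by simp only [Polynomial.map_X, hΦ, hQ.one])
        coeff_zero := fun a => hφ (by rw [← coeff_map, hΦ, hQ.coeff_zero, map_zero]) }
    have hΦ0 : ∀ b n, φ ((Φ b).coeff n) * (u : K) ^ n = u * (Q₀ b).coeff n := fun b n => by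
      rw [← coeff_map, hΦ, hcoeff]
    have hΦ1 : ∀ b, φ ((Φ b).coeff 1) = fN b := fun b => by
      have := hΦ0 b 1
      rw [pow_one, mul_comm, hQ₀.coeff_one] at this
      exact mul_left_cancel₀ u.ne_zero this
    have hΦD : IsDrinfeldAction C'.constants (C'.tauDegree r') hΦP.slope Φ :=
      { hΦP with
        coeff_one := fun b => rfl
        constants := fun ζ => hinj <| hcancel _ _ <| by
          rw [hΦ, hQu, hQ₀.constants, ← hΦ1]
          simp [hΦP.slope_apply]
          ring
        exists_tauPoly := fun b => by
          obtain ⟨δ, hδ⟩ := hQ₀.exists_tauPoly b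
          refine DrinfeldRestriction.exists_tauPoly hq _ fun m hm => ?_
          have h1 : (Q₀ b).coeff m ≠ 0 := fun h => hm <| hφ <| by
            have := hΦ0 b m
            rw [h, mul_zero] at this
            rw [map_zero]
            exact (mul_eq_zero.mp this).resolve_right (pow_ne_zero _ u.ne_zero)
          rw [hδ, tauPoly, Finsupp.sum, finsetSum_coeff] at h1
          obtain ⟨i, -, hi⟩ := Finset.exists_ne_zero_of_sum_ne_zero h1
          rw [coeff_C_mul, coeff_X_pow] at hi
          by_contra hne
          exact hi (by rw [if_neg fun e => hne ⟨i, e⟩, mul_zero])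
        natDegree := fun {b} hb => by
          rw [← natDegree_map_eq_of_injective hφ, hΦ, hdeg, hQ₀.natDegree hb]
        isUnit := fun {b} hb => hΦu b hb }
    obtain ⟨E, ⟨e⟩⟩ := GaAction.exists_moduleScheme eM hΦP fun b T y z => by
      obtain ⟨δ, hδ⟩ := hΦD.exists_tauPoly b
      rw [hδ]
      exact eval₂_tauPoly_add (hΦP.slope.comp C'.constants) _ δ y z
    refine ⟨Quotient.mk _ ⟨_, E, e.isDrinfeld hΦD⟩, Quotient.sound ⟨?_, ?_⟩,
      Quotient.sound ⟨?_, ?_⟩⟩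
    · change Spec.map _ ≫ Spec.map _ = N.char
      rw [hN, ← Spec.map_comp]
      congr 1
      ext b
      exact hΦ1 b
    · refine (e.pullback φ).isomorphic eN u⁻¹ fun b => ?_
      refine hcancel _ _ ?_
      rw [hΦ, mul_comp, hQu]
      simp [comp_assoc, ← mul_assoc, ← C_mul]
    · change Spec.map _ ≫ Spec.map π.coordMap = M.char
      rw [hM, ← Spec.map_comp]
      congr 1
      ext a
      change (Φ (π.coordMap a)).coeff 1 = fM a
      rw [← hP.coeff_one, hinj ((hΦ _).trans (hPQ a))]
    · refine (e.restrictScalars π.coordMap).isomorphic eM 1 fun a => ?_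
      simp [hinj ((hΦ _).trans (hPQ a))]
  · rintro z₁ z₂ ⟨h₁, -⟩ ⟨h₂, -⟩
    induction z₁ using Quotient.inductionOn with | _ M₁
    induction z₂ using Quotient.inductionOn with | _ M₂
    obtain ⟨hc, hiso⟩ := Quotient.exact (h₁.trans h₂.symm)
    obtain ⟨f₁, P₁, hf₁, hP₁, ⟨e₁⟩⟩ := M₁.exists_gaAction
    obtain ⟨f₂, P₂, hf₂, hP₂, ⟨e₂⟩⟩ := M₂.exists_gaAction
    obtain ⟨u, hu⟩ := (e₁.pullback φ).exists_unit (e₂.pullback φ) hiso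
    obtain ⟨v, hv⟩ := IsPolyAction.exists_unit_intertwining hP₁.toIsPolyAction hP₂.toIsPolyAction
      (fun b hb => hP₁.isUnit hb) (fun b hb => hP₂.isUnit hb) u.ne_zero hu
    refine Quotient.sound ⟨?_, e₁.isomorphic e₂ v hv⟩
    change Spec.map (CommRingCat.ofHom φ) ≫ M₁.char = Spec.map (CommRingCat.ofHom φ) ≫ M₂.char at hc
    rw [hf₁, hf₂, ← Spec.map_comp, ← Spec.map_comp] at hc
    have := Spec.map_injective hc
    rw [hf₁, hf₂]
    congr 1
    ext b
    exact hφ congr($this b)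

end

end DrinfeldRestriction

end


theorem theorem2p4 {k : Type u} [Field k] [Finite k] {C' C : DrinfeldRestriction.PointedCurve k}
    (π : DrinfeldRestriction.PointedCurve.Cover C' C) (r' : ℕ) (hr' : 0 < r') :
    ∃ ρ : DrinfeldRestriction.moduli C' r' ⟶ DrinfeldRestriction.moduli C (π.degree * r'),
      DrinfeldRestriction.IsRestrictionOfCoefficients π ρ ∧
        DrinfeldRestriction.ValuativeCriterion ρ := by
  exact ⟨_, DrinfeldRestriction.isRestrictionOfCoefficients π r',
    DrinfeldRestriction.valuativeCriterion_moduliRestrict π r'⟩
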